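/- Let $N\ge 0$ be an integer, $\mathbb T^{n}=(\mathbb R/2\pi\mathbb Z)^{n}$, $S^1=\mathbb T^1$, and write $(t,x)\in S^1\times\mathbb T^N=\mathbb T^{N+1}$. The space $C^\infty(\mathbb T^{n})$ carries its usual topology of uniform convergence of all derivatives. For a continuous linear operator $Q$ on $C^\infty(\mathbb T^n)$ its discrete symbol is $Q(y,\eta)=e^{-iy\cdot\eta}\,Q(e^{iy\cdot\eta})$, $\eta\in\mathbb Z^n$, and $Q$ is a pseudodifferential operator of order $m$ if for every multi-index $\alpha$ there is $C_\alpha>0$ with $|D_y^\alpha Q(y,\eta)|\le C_\alpha(1+|\eta|)^m$ for all $y\in\mathbb T^n$, $\eta\in\mathbb Z^n$. Let $m\ge 1$ be an integer and let $c(t,D_x)$ be a pseudodifferential operator of order $m$ on $\mathbb T^{N+1}$ of tube type, i.e. its discrete symbol at $(t,x)\in\mathbb T^{N+1}$, $(\tau,\xi)\in\mathbb Z\times\mathbb Z^N$ is a function $c(t,\xi)$ of $(t,\xi)$ only. Suppose that it is positively homogeneous of degree $m$: $c(t,n\xi)=n^m c(t,\xi)$ for all $t\in S^1$, $\xi\in\mathbb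 Z^N$ and all integers $n\ge1$. Put $D_t=-i\partial_t$, $P=D_t+c(t,D_x)$, $b=\operatorname{Im}c$, let $B(\cdot,\xi)$ be a primitive of $b(\cdot,\xi)$ for each $\xi$, and put $c_0(\xi)=\frac1{2\pi}\int_0^{2\pi}c(t,\xi)\,dt$ and $\mathcal Z=\{\xi\in\mathbb Z^N: c_0(\xi)\in\mathbb Z\}$. For $\xi\in\mathcal Z$ the function $B(\cdot,\xi)$ is $2\pi$-periodic, hence a function on $S^1$. The operator $P$ is called globally solvable if its range is closed in $C^\infty(\mathbb T^{N+1})$. For $D>0$ and $\xi\in\mathcal Z\setminus\{0\}$, and for a point $t_\xi\in S^1$ where $B(\cdot,\xi)$ attains its maximum, $P$ satisfies $(\beta)_D$ at $\xi$ if for every $t\in S^1\setminus\{t_\xi\}$ at least one of the following holds, where $[t_1,t_2]\subset S^1$ is the anticlockwise arc from $t_1$ to $t_2$: (a) every open interval $I\subset[t,t_\xi]$ of length $|I|\ge|\xi|^{-m}$ contains a point $s$ with $B(t,\xi)-B(s,\xi)\le D\log|\xi|$; (b) every open interval $I\subset[t_\xi,t]$ of length $|I|\ge|\xi|^{-m}$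 contains a point $s$ with $B(t,\xi)-B(s,\xi)\le D\log|\xi|$. Let $\xi_0\in\mathbb Z^N\setminus\{0\}$ satisfy $c_0(\xi_0)\in\mathbb Z$, and suppose that for some $\lambda\in\mathbb R$ the set $\Omega_\lambda=\{t\in S^1: B(t,\xi_0)<\lambda\}$ is disconnected (the empty set counts as connected). Then $P$ is not globally solvable. Moreover, for every $D>0$ there is $n_0\in\mathbb N$ such that for every integer $n\ge n_0$ one has $n\xi_0\in\mathcal Z\setminus\{0\}$ and, for every choice of the maximum point $t_{n\xi_0}$, $P$ does not satisfy $(\beta)_D$ at $n\xi_0$. -/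

import Mathlib

open Real Set
open scoped ContDiff

noncomputable section

namespace TorusPDO

/-- The complex vector space of smooth functions on `ℝⁿ` that are `2π`-periodic in every variable. -/
def smoothPeriodic (n : ℕ) : Submodule ℂ ((Fin n → ℝ) → ℂ) where
  carrier := {f | ContDiff ℝ ∞ f ∧
    ∀ (y : Fin n → ℝ) (k : Fin n → ℤ), f (fun i => y i + 2 * π * (k i : ℝ)) = f y}
  zero_mem' := ⟨contDiff_const, fun _ _ => rfl⟩
  add_mem' := by
    rintro f g ⟨hf, hf'⟩ ⟨hg, hg'⟩
    exact ⟨hf.add hg, fun y k => by simp only [Pi.add_apply, hf', hg']⟩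
  smul_mem' := by
    rintro a f ⟨hf, hf'⟩
    exact ⟨contDiff_const.smul hf, fun y k => by simp only [Pi.smul_apply, hf']⟩

/-- `C^∞(𝕋ⁿ)`, with `𝕋ⁿ = ℝⁿ / (2πℤ)ⁿ`. It is a new type, so that it carries the topology
declared below and not the one of pointwise convergence. -/
def SmoothTorus (n : ℕ) : Type := ↥(smoothPeriodic n)

instance (n : ℕ) : AddCommGroup (SmoothTorus n) := inferInstanceAs (AddCommGroup ↥(smoothPeriodic n))

instance (n : ℕ) : Module ℂ (SmoothTorus n) := inferInstanceAs (Module ℂ ↥(smoothPeriodic n))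

instance (n : ℕ) : FunLike (SmoothTorus n) (Fin n → ℝ) ℂ where
  coe f := Subtype.val (p := fun g => g ∈ smoothPeriodic n) f
  coe_injective _ _ h := Subtype.ext h

/-- A smooth periodic function as an element of `C^∞(𝕋ⁿ)`. -/
def SmoothTorus.mk {n : ℕ} (f : (Fin n → ℝ) → ℂ) (hf : ContDiff ℝ ∞ f)
    (hp : ∀ (y : Fin n → ℝ) (k : Fin n → ℤ), f (fun i => y i + 2 * π * (k i : ℝ)) = f y) :
    SmoothTorus n :=
  Subtype.mk (p := fun g => g ∈ smoothPeriodic n) f ⟨hf, hp⟩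

theorem SmoothTorus.contDiff {n : ℕ} (f : SmoothTorus n) : ContDiff ℝ ∞ (f : (Fin n → ℝ) → ℂ) :=
  f.2.1

theorem SmoothTorus.periodic {n : ℕ} (f : SmoothTorus n) (y : Fin n → ℝ) (k : Fin n → ℤ) :
    f (fun i => y i + 2 * π * (k i : ℝ)) = f y :=
  f.2.2 y k

/-- The usual topology of `C^∞(𝕋ⁿ)`: uniform convergence of the derivatives of every order. -/
instance (n : ℕ) : TopologicalSpace (SmoothTorus n) :=
  ⨅ k : ℕ, TopologicalSpace.induced
    (fun f : SmoothTorus n => UniformFun.ofFun (iteratedFDeriv ℝ k (f : (Fin n → ℝ) → ℂ)))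
    inferInstance

/-- The scalar product `y · η`. -/
def dot {n : ℕ} (y : Fin n → ℝ) (η : Fin n → ℤ) : ℝ := ∑ i, y i * (η i : ℝ)

/-- The Euclidean norm `|η|` of `η ∈ ℤⁿ`. -/
def intNorm {n : ℕ} (η : Fin n → ℤ) : ℝ := Real.sqrt (∑ i, (η i : ℝ) ^ 2)

/-- The exponential `y ↦ e^{i y · η}`. -/
def expo {n : ℕ} (η : Fin n → ℤ) : SmoothTorus n :=
  SmoothTorus.mk (fun y => Complex.exp (Complex.I * (dot y η : ℝ)))
    (by
      have h1 : ContDiff ℝ ∞ (fun y : Fin n → ℝ => dot y η) := by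
        unfold dot
        fun_prop
      exact (contDiff_const.mul (Complex.ofRealCLM.contDiff.comp h1)).cexp)
    (by
      intro y k
      rw [Complex.exp_eq_exp_iff_exists_int]
      refine ⟨∑ i, k i * η i, ?_⟩
      simp only [dot]
      push_cast
      simp only [add_mul, Finset.sum_add_distrib, Finset.mul_sum, mul_add, Finset.sum_mul]
      congr 1
      refine Finset.sum_congr rfl fun i _ => ?_
      ring)

/-- The discrete symbol `Q(y, η) = e^{-i y · η} Q(e^{i y · η})` of an operator `Q`. -/
def discreteSymbol {n : ℕ} (Q : SmoothTorus n →L[ℂ] SmoothTorus n)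
    (y : Fin n → ℝ) (η : Fin n → ℤ) : ℂ :=
  Complex.exp (-(Complex.I * (dot y η : ℝ))) * Q (expo η) y

/-- The continuous linear operator `Q` belongs to `S^m(𝕋ⁿ × ℤⁿ)`: every partial derivative in `y`
of the discrete symbol is bounded by a constant times `(1 + |η|)^m`. A partial derivative of order
`k` is given by its list `v` of `k` coordinate directions; `D^α` is the one (up to the factor
`(-i)^{|α|}`) whose list contains each `i` exactly `α i` times. -/
def IsPseudoDiff {n : ℕ} (m : ℝ) (Q : SmoothTorus n →L[ℂ] SmoothTorus n) : Prop :=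
  ∀ (k : ℕ) (v : Fin k → Fin n), ∃ K : ℝ, 0 < K ∧ ∀ (y : Fin n → ℝ) (η : Fin n → ℤ),
    ‖iteratedFDeriv ℝ k (fun z => discreteSymbol Q z η) y (fun j => Pi.single (v j) (1 : ℝ))‖
      ≤ K * (1 + intNorm η) ^ m

/-- `Q` is of tube type on `𝕋^{N+1} = S¹ × 𝕋^N` with symbol `c`: at `y = (t, x)` and
`η = (τ, ξ)` the discrete symbol of `Q` is `c(t, ξ)`. The variable `t` is the coordinate `0`. -/
def HasTubeSymbol {N : ℕ} (Q : SmoothTorus (N + 1) →L[ℂ] SmoothTorus (N + 1))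
    (c : ℝ → (Fin N → ℤ) → ℂ) : Prop :=
  ∀ (y : Fin (N + 1) → ℝ) (η : Fin (N + 1) → ℤ), discreteSymbol Q y η = c (y 0) (Fin.tail η)

/-- Positive homogeneity of degree `m` of the symbol in `ξ`. -/
def IsPosHomogeneous {N : ℕ} (m : ℕ) (c : ℝ → (Fin N → ℤ) → ℂ) : Prop :=
  ∀ (n : ℕ), 1 ≤ n → ∀ (t : ℝ) (ξ : Fin N → ℤ), c t (n • ξ) = (n : ℂ) ^ m * c t ξ

/-- `D_t = -i ∂/∂t` on `C^∞(𝕋^{N+1})`. -/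
def Dt {N : ℕ} (u : SmoothTorus (N + 1)) : SmoothTorus (N + 1) :=
  SmoothTorus.mk (fun y => -Complex.I * fderiv ℝ u y (Pi.single 0 1))
    (contDiff_const.mul ((u.contDiff.fderiv_right (m := ∞) (by simp)).clm_apply contDiff_const))
    (by
      intro y k
      have h : (fun z => u (z + fun i => 2 * π * (k i : ℝ))) = u := funext fun z => u.periodic z k
      have h2 := fderiv_comp_add_right (𝕜 := ℝ) (f := u) (x := y) (fun i => 2 * π * (k i : ℝ))
      rw [h] at h2
      have h3 : (fun i => y i + 2 * π * (k i : ℝ)) = y + fun i => 2 * π * (k i : ℝ) := rfl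
      rw [h3, ← h2])

/-- The operator `P = D_t + c(t, D_x)`, where `Q = c(t, D_x)`. -/
def opP {N : ℕ} (Q : SmoothTorus (N + 1) →L[ℂ] SmoothTorus (N + 1))
    (u : SmoothTorus (N + 1)) : SmoothTorus (N + 1) := Dt u + Q u

/-- Global solvability: the range of the operator is closed in `C^∞(𝕋ⁿ)`. -/
def IsGloballySolvable {n : ℕ} (P : SmoothTorus n → SmoothTorus n) : Prop :=
  IsClosed (Set.range P)

/-- The average `c₀(ξ) = (2π)⁻¹ ∫₀^{2π} c(t, ξ) dt`. -/
def average {N : ℕ} (c : ℝ → (Fin N → ℤ) → ℂ) (ξ : Fin N → ℤ) : ℂ :=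
  (2 * (π : ℂ))⁻¹ * ∫ t in (0 : ℝ)..(2 * π), c t ξ

/-- The set `𝒵` of all `ξ ∈ ℤ^N` with `c₀(ξ) ∈ ℤ`. -/
def resonantSet {N : ℕ} (c : ℝ → (Fin N → ℤ) → ℂ) : Set (Fin N → ℤ) :=
  {ξ | ∃ k : ℤ, average c ξ = (k : ℂ)}

/-- For every `ξ`, the function `B(·, ξ)` is a primitive of `b(·, ξ) = Im c(·, ξ)`. -/
def IsPrimitiveIm {N : ℕ} (c : ℝ → (Fin N → ℤ) → ℂ) (B : ℝ → (Fin N → ℤ) → ℝ) : Prop :=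
  ∀ (ξ : Fin N → ℤ) (t : ℝ), HasDerivAt (fun s => B s ξ) (c t ξ).im t

/-- The sublevel set `{t ∈ S¹ : F(t) < lam}`, with `S¹ = ℝ / 2πℤ`, of a `2π`-periodic `F`. -/
def circleSublevel (F : ℝ → ℝ) (lam : ℝ) : Set (AddCircle (2 * π)) :=
  (fun t : ℝ => (t : AddCircle (2 * π))) '' {t | F t < lam}

/-- The condition `(β)_D` at `ξ ∈ 𝒵 ∖ {0}` for the order `m`, the primitive `B(·, ξ)` and the
maximum point `tmax` of `B(·, ξ)`. A point of `S¹ ∖ {tmax}` is represented by the unique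
`t ∈ (tmax - 2π, tmax)`; then the anticlockwise arcs from `t` to `tmax` and from `tmax` to `t` are
the images of `[t, tmax]` and `[tmax - 2π, t]`, and their open subintervals are the images
of the intervals `(p, q)` below. -/
def SatisfiesBeta {N : ℕ} (m D : ℝ) (B : ℝ → (Fin N → ℤ) → ℝ) (ξ : Fin N → ℤ) (tmax : ℝ) : Prop :=
  ∀ t ∈ Ioo (tmax - 2 * π) tmax,
    (∀ p q : ℝ, p < q → Ioo p q ⊆ Icc t tmax → intNorm ξ ^ (-m) ≤ q - p →
      ∃ s ∈ Ioo p q, B t ξ - B s ξ ≤ D * Real.log (intNorm ξ)) ∨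
    (∀ p q : ℝ, p < q → Ioo p q ⊆ Icc (tmax - 2 * π) t → intNorm ξ ^ (-m) ≤ q - p →
      ∃ s ∈ Ioo p q, B t ξ - B s ξ ≤ D * Real.log (intNorm ξ))

end TorusPDO

end

open TorusPDO

/-! Disconnectedness of the sublevel set gives points a < p < b < q < a + 2π with B(a), B(b) < lam ≤
B(p), B(q) at ξ₀ (`exists_separated_of_not_isPreconnected`). Both conclusions rest on these four
points, amplified along the ray nξ₀, where homogeneity multiplies differences of B by n^m.

Nonsolvability. Let C be a primitive of c(·, ξ₀), so that |e^{-iC}| = e^{Im C} with Im C = B up to a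
constant. Since c₀(ξ₀) is an integer, e^{-iC} is periodic; it solves the homogeneous equation at
frequency ξ₀. Take χ as a bump at a minus the same bump at b. It has mean zero, hence a periodic
primitive, so f_n = -iχ e^{-n^m(iC + μ)} e^{i n x·ξ₀} lies in the range of P
(`HasTubeSymbol.exists_opP_eq_wave`). The level μ is placed strictly between the values of Im C on
supp χ and those at p and q. Then f_n and its derivatives decay like e^{-ε n^m} up to powers of n^m,
and g = ∑ f_n converges in C^∞ to a point of the closure of the range
(`exists_bound_iteratedFDeriv_mul_exp`, `SmoothTorus.exists_hasSum`). If g = Pu, integrate against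
e^{i n^m C} e^{-i n x·ξ₀} over [p, q] × [0, 2π]^N. Only the faces t = p and t = q contribute on the
side of Pu (`HasTubeSymbol.integral_slab_opP`), with size O(e^{-n^m(μ + ε)}). On the side of g only
f_n survives, and only its bump at b, which gives κ e^{-n^m μ} in modulus with κ > 0. Letting n → ∞
is a contradiction.

Failure of (β)_D. Between consecutive copies of the maximum point lie translates of a and b,
separated by a translate γ of p or q. On fixed windows around both translates, B(γ, nξ₀) - B(s, nξ₀)
is at least a constant times n^m, which beats D log(n|ξ₀|), while the required length (n|ξ₀|)^{-m}
shrinks to 0. So neither arc issuing from γ satisfies the condition.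

Q is known only through its symbol on exponentials; continuity of Q and C^∞ convergence of Fourier
series extend this to all functions needed. -/

noncomputable section

namespace TorusPDO

open Filter Topology MeasureTheory

/-! ### Derivative bounds for periodic functions and for exponentials. -/

section Bounds

/-- A continuous function on `ℝⁿ` that is `2π`-periodic in every variable is bounded. -/
theorem exists_bound_of_periodic {n : ℕ} {E : Type*} [NormedAddCommGroup E]
    {f : (Fin n → ℝ) → E} (hf : Continuous f)
    (hp : ∀ (y : Fin n → ℝ) (k : Fin n → ℤ), f (fun i => y i + 2 * π * (k i : ℝ)) = f y) :
    ∃ K : ℝ, ∀ y, ‖f y‖ ≤ K := by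
  obtain ⟨K, hK⟩ := (isCompact_Icc (a := (0 : Fin n → ℝ)) (b := fun _ => 2 * π)).exists_bound_of_continuousOn
    hf.continuousOn
  refine ⟨K, fun y => ?_⟩
  have hpos : (0 : ℝ) < 2 * π := by positivity
  rw [← hp y (fun i => -⌊y i / (2 * π)⌋)]
  refine hK _ ⟨fun i => ?_, fun i => ?_⟩
  · have := Int.floor_le (y i / (2 * π))
    rw [le_div_iff₀ hpos] at this
    simp only [Pi.zero_apply]
    push_cast
    linarith
  · have := (Int.lt_floor_add_one (y i / (2 * π))).le
    rw [div_le_iff₀ hpos] at this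
    simp only
    push_cast
    linarith

/-- The derivatives of positive order of a smooth function are bounded if the function is periodic
up to additive constants. -/
theorem exists_bound_iteratedFDeriv_of_quasiperiodic {n : ℕ} {f : (Fin n → ℝ) → ℂ}
    (hf : ContDiff ℝ ∞ f)
    (hp : ∀ k : Fin n → ℤ, ∃ z : ℂ, ∀ y, f (fun i => y i + 2 * π * (k i : ℝ)) = f y + z) (i : ℕ) :
    ∃ K : ℝ, ∀ y, ‖iteratedFDeriv ℝ (i + 1) f y‖ ≤ K := by
  obtain ⟨K, hK⟩ := exists_bound_of_periodic (f := iteratedFDeriv ℝ i (fderiv ℝ f))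
    ((hf.fderiv_right (m := ∞) (by simp)).continuous_iteratedFDeriv (mod_cast le_top)) (by
      intro y k
      have h1 : (fun z => fderiv ℝ f (z + fun i => 2 * π * (k i : ℝ))) = fderiv ℝ f := by
        funext z
        -- The additive constant of quasi-periodicity disappears after one derivative, so `fderiv ℝ
        -- f` is truly periodic.
        rw [← fderiv_comp_add_right]
        obtain ⟨w, hw⟩ := hp k
        have : (fun x => f (x + fun i => 2 * π * (k i : ℝ))) = fun x => f x + w := funext hw
        rw [this, fderiv_add_const]
      have h2 := iteratedFDeriv_comp_add_right (𝕜 := ℝ) (f := fderiv ℝ f) i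
        (fun i => 2 * π * (k i : ℝ)) y
      rw [h1] at h2
      exact h2.symm)
  exact ⟨K, fun y => by rw [← norm_iteratedFDeriv_fderiv]; exact hK y⟩

theorem SmoothTorus.exists_bound_iteratedFDeriv {n : ℕ} (f : SmoothTorus n) (i : ℕ) :
    ∃ K : ℝ, ∀ y, ‖iteratedFDeriv ℝ i (f : (Fin n → ℝ) → ℂ) y‖ ≤ K := by
  refine exists_bound_of_periodic (f.contDiff.continuous_iteratedFDeriv (mod_cast le_top)) ?_
  intro y k
  have h1 : (fun z => f (z + fun i => 2 * π * (k i : ℝ))) = f := funext fun z => f.periodic z k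
  have h2 := iteratedFDeriv_comp_add_right (𝕜 := ℝ) (f := f) i (fun i => 2 * π * (k i : ℝ)) y
  rw [h1] at h2
  exact h2.symm

theorem SmoothTorus.exists_bound {n : ℕ} (f : SmoothTorus n) : ∃ K : ℝ, ∀ y, ‖f y‖ ≤ K :=
  exists_bound_of_periodic f.contDiff.continuous f.periodic

/-- The real derivative of exp at w is multiplication by exp w, that is, exp followed by a linear
map of norm at most 1; each further derivative therefore costs nothing. -/
theorem norm_iteratedFDeriv_cexp_le (i : ℕ) (z : ℂ) :
    ‖iteratedFDeriv ℝ i Complex.exp z‖ ≤ ‖Complex.exp z‖ := by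
  induction i with
  | zero => simp
  | succ i ih =>
    rw [← norm_iteratedFDeriv_fderiv]
    have h : fderiv ℝ Complex.exp = ⇑(ContinuousLinearMap.mul ℝ ℂ) ∘ Complex.exp := by
      funext w
      rw [(Complex.hasStrictFDerivAt_exp_real w).hasFDerivAt.fderiv]
      ext
      all_goals simp
    rw [h]
    refine ((ContinuousLinearMap.mul ℝ ℂ).norm_iteratedFDeriv_comp_left (N := ∞)
      Complex.contDiff_exp.contDiffAt (mod_cast le_top)).trans ?_
    calc _ ≤ 1 * ‖iteratedFDeriv ℝ i Complex.exp z‖ := by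
          gcongr
          exact ContinuousLinearMap.opNorm_mul_le ℝ ℂ
      _ ≤ _ := by rw [one_mul]; exact ih

/-- Faà di Bruno. What matters is that k derivatives of e^F cost only D^k, polynomial in the size of
the phase, besides |e^F| itself. -/
theorem norm_iteratedFDeriv_cexp_comp_le {E : Type*} [NormedAddCommGroup E] [NormedSpace ℝ E]
    {F : E → ℂ} (hF : ContDiff ℝ ∞ F) (k : ℕ) (x : E) {D : ℝ} (hD1 : 1 ≤ D)
    (hD : ∀ i, 1 ≤ i → i ≤ k → ‖iteratedFDeriv ℝ i F x‖ ≤ D) :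
    ‖iteratedFDeriv ℝ k (fun y => Complex.exp (F y)) x‖
      ≤ k.factorial * ‖Complex.exp (F x)‖ * D ^ k :=
  norm_iteratedFDeriv_comp_le (N := ∞) (g := Complex.exp) Complex.contDiff_exp hF
    (mod_cast le_top) x (fun i _ => norm_iteratedFDeriv_cexp_le i _)
    fun i hi hik => (hD i hi hik).trans (le_self_pow₀ hD1 (by omega))

end Bounds

/-! ### Convergence of sequences and series in C^∞ of the torus. -/

section Topology

variable {n : ℕ}

@[simp]
theorem SmoothTorus.add_apply (f g : SmoothTorus n) (y : Fin n → ℝ) : (f + g) y = f y + g y := rfl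

@[simp]
theorem SmoothTorus.smul_apply (a : ℂ) (f : SmoothTorus n) (y : Fin n → ℝ) :
    (a • f) y = a * f y := rfl

@[simp]
theorem SmoothTorus.zero_apply (y : Fin n → ℝ) : (0 : SmoothTorus n) y = 0 := rfl

@[ext]
theorem SmoothTorus.ext {f g : SmoothTorus n} (h : ∀ y, f y = g y) : f = g :=
  DFunLike.ext _ _ h

theorem SmoothTorus.sum_apply {ι : Type*} (s : Finset ι) (v : ι → SmoothTorus n)
    (y : Fin n → ℝ) : (∑ i ∈ s, v i) y = ∑ i ∈ s, v i y := by
  classical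
  induction s using Finset.induction_on with
  | empty => simp
  | insert a s ha ih => simp [Finset.sum_insert ha, ih]

theorem SmoothTorus.tendsto_iff {ι : Type*} {l : Filter ι} {F : ι → SmoothTorus n}
    {f : SmoothTorus n} :
    Tendsto F l (𝓝 f) ↔ ∀ k : ℕ, TendstoUniformly
      (fun i => iteratedFDeriv ℝ k (F i : (Fin n → ℝ) → ℂ)) (iteratedFDeriv ℝ k f) l := by
  rw [nhds_iInf, tendsto_iInf]
  refine forall_congr' fun k => ?_
  rw [nhds_induced, tendsto_comap_iff, UniformFun.tendsto_iff_tendstoUniformly]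
  rfl

theorem SmoothTorus.tendstoUniformly {ι : Type*} {l : Filter ι} {F : ι → SmoothTorus n}
    {f : SmoothTorus n} (h : Tendsto F l (𝓝 f)) : TendstoUniformly (fun i => ⇑(F i)) f l := by
  have h0 := SmoothTorus.tendsto_iff.1 h 0
  rw [Metric.tendstoUniformly_iff] at h0 ⊢
  intro ε hε
  filter_upwards [h0 ε hε] with i hi y
  have := hi y
  rw [dist_eq_norm] at this ⊢
  have h2 : f y - F i y = (iteratedFDeriv ℝ 0 f y - iteratedFDeriv ℝ 0 (F i) y) ![] := by
    simp
  rw [h2]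
  refine ((iteratedFDeriv ℝ 0 f y - iteratedFDeriv ℝ 0 (F i) y).le_opNorm _).trans_lt ?_
  simpa using this

/-- A series of smooth functions on the torus converges in `C^∞` if the derivatives of every order
are dominated by a summable family. -/
theorem SmoothTorus.exists_hasSum {ι : Type*} (v : ι → SmoothTorus n) (A : ℕ → ι → ℝ)
    (hA : ∀ k, Summable (A k))
    (hv : ∀ k i y, ‖iteratedFDeriv ℝ k (v i : (Fin n → ℝ) → ℂ) y‖ ≤ A k i) :
    ∃ g : SmoothTorus n, HasSum v g ∧ ∀ y, g y = ∑' i, v i y := by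
  have hsm : ContDiff ℝ ∞ (fun y => ∑' i, v i y) :=
    contDiff_tsum (N := ⊤) (v := A) (fun i => (v i).contDiff) (fun k _ => hA k)
      (fun k i y _ => hv k i y)
  refine ⟨SmoothTorus.mk _ hsm fun y k => by simp only [SmoothTorus.periodic], ?_, fun y => rfl⟩
  rw [HasSum, SummationFilter.unconditional_filter, SmoothTorus.tendsto_iff]
  intro k
  have h1 : ∀ s : Finset ι, iteratedFDeriv ℝ k (∑ i ∈ s, v i : SmoothTorus n) =
      fun y => ∑ i ∈ s, iteratedFDeriv ℝ k (v i) y := by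
    intro s
    have : ((∑ i ∈ s, v i : SmoothTorus n) : (Fin n → ℝ) → ℂ) = fun y => ∑ i ∈ s, v i y :=
      funext fun y => SmoothTorus.sum_apply s v y
    rw [this, iteratedFDeriv_sum fun j _ => (v j).contDiff.of_le (mod_cast le_top)]
    funext y
    simp
  have h2 : iteratedFDeriv ℝ k (SmoothTorus.mk _ hsm fun y k => by
      simp only [SmoothTorus.periodic] : SmoothTorus n) =
      fun y => ∑' i, iteratedFDeriv ℝ k (v i) y :=
    iteratedFDeriv_tsum (N := ⊤) (v := A) (fun i => (v i).contDiff) (fun k _ => hA k)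
      (fun k i y _ => hv k i y) (mod_cast le_top)
  simp only [h1, h2]
  exact tendstoUniformly_tsum (hA k) (hv k)

theorem SmoothTorus.hasSum_apply {ι : Type*} {v : ι → SmoothTorus n} {g : SmoothTorus n}
    (h : HasSum v g) (y : Fin n → ℝ) : HasSum (fun i => v i y) (g y) := by
  have h1 := (SmoothTorus.tendstoUniformly h).tendsto_at y
  rw [HasSum, SummationFilter.unconditional_filter]
  simpa only [SmoothTorus.sum_apply, SummationFilter.unconditional_filter] using h1

theorem SmoothTorus.integrableOn_mul (u : SmoothTorus n) {w : (Fin n → ℝ) → ℂ} (hw : Continuous w)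
    (a b : Fin n → ℝ) : IntegrableOn (fun y => u y * w y) (Icc a b) :=
  (u.contDiff.continuous.mul hw).integrableOn_Icc

/-- Convergence in C^∞ is in particular uniform, and the box has finite volume, so pairing with a
continuous weight may be done term by term. -/
theorem SmoothTorus.hasSum_integral {ι : Type*} {v : ι → SmoothTorus n} {g : SmoothTorus n}
    (h : HasSum v g) {w : (Fin n → ℝ) → ℂ} (hw : Continuous w) (a b : Fin n → ℝ) :
    HasSum (fun i => ∫ y in Icc a b, v i y * w y) (∫ y in Icc a b, g y * w y) := by
  have h1 := SmoothTorus.tendstoUniformly h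
  rw [HasSum, SummationFilter.unconditional_filter]
  have h2 : ∀ s : Finset ι, ∑ i ∈ s, ∫ y in Icc a b, v i y * w y =
      ∫ y in Icc a b, (∑ i ∈ s, v i : SmoothTorus n) y * w y := by
    intro s
    rw [← integral_finsetSum _ fun i _ => (v i).integrableOn_mul hw a b]
    simp only [SmoothTorus.sum_apply, Finset.sum_mul]
  simp only [h2]
  obtain ⟨K, hK⟩ := (isCompact_Icc (a := a) (b := b)).exists_bound_of_continuousOn hw.continuousOn
  set V : ℝ := volume.real (Icc a b)
  rw [Metric.tendsto_nhds]
  intro ε hε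
  have hK1 : 0 < |K| * V + 1 := by positivity
  filter_upwards [Metric.tendstoUniformly_iff.1 h1 (ε / (|K| * V + 1)) (by positivity)] with s hs
  rw [dist_comm, dist_eq_norm, ← integral_sub (g.integrableOn_mul hw a b)
    ((∑ i ∈ s, v i : SmoothTorus n).integrableOn_mul hw a b)]
  have h3 : ∀ y ∈ Icc a b, ‖g y * w y - (∑ i ∈ s, v i : SmoothTorus n) y * w y‖ ≤
      ε / (|K| * V + 1) * |K| := by
    intro y hy
    rw [← sub_mul, norm_mul, ← dist_eq_norm]
    exact mul_le_mul (hs y).le ((hK y hy).trans (le_abs_self K)) (norm_nonneg _) (by positivity)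
  refine (norm_setIntegral_le_of_norm_le_const isCompact_Icc.measure_lt_top h3).trans_lt ?_
  rw [div_mul_eq_mul_div, div_mul_eq_mul_div, div_lt_iff₀ hK1]
  nlinarith

end Topology

/-- The fundamental theorem of calculus in the direction `j`, integrated over a box. -/
theorem integral_Icc_partialDeriv {n : ℕ} {a b : Fin (n + 1) → ℝ} (hab : a ≤ b) (j : Fin (n + 1))
    {f : (Fin (n + 1) → ℝ) → ℂ} (hf : ContDiff ℝ 1 f) :
    ∫ y in Icc a b, fderiv ℝ f y (Pi.single j 1) =
      (∫ x in Icc (a ∘ j.succAbove) (b ∘ j.succAbove), f (j.insertNth (b j) x)) -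
        ∫ x in Icc (a ∘ j.succAbove) (b ∘ j.succAbove), f (j.insertNth (a j) x) := by
  have hd : Differentiable ℝ f := hf.differentiable (by simp)
  have hc : Continuous fun y => fderiv ℝ f y (Pi.single j 1) :=
    (hf.continuous_fderiv (by simp)).clm_apply continuous_const
  -- Divergence theorem for the vector field whose only nonzero component is f, in direction j.
  have key := integral_divergence_of_hasFDerivAt_off_countable' a b hab
    (Pi.single j f) (Pi.single j (fderiv ℝ f)) ∅ countable_empty
    (fun i => by
      obtain rfl | h := eq_or_ne i j
      · simpa using hf.continuous.continuousOn
      · simpa [Pi.single_eq_of_ne h] using! (continuousOn_const (c := (0 : ℂ))))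
    (fun x _ i => by
      obtain rfl | h := eq_or_ne i j
      · simpa using (hd x).hasFDerivAt
      · simpa [Pi.single_eq_of_ne h] using! hasFDerivAt_const (0 : ℂ) x)
    (by
      refine Continuous.integrableOn_Icc ?_
      refine continuous_finsetSum _ fun i _ => ?_
      obtain rfl | h := eq_or_ne i j
      · simpa using hc
      · simpa [Pi.single_eq_of_ne h] using continuous_const)
  have h1 : ∀ x, ∑ i, (Pi.single j (fderiv ℝ f) : Fin (n + 1) → _ → _ →L[ℝ] ℂ) i x
      (Pi.single i 1) = fderiv ℝ f x (Pi.single j 1) := by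
    intro x
    rw [Finset.sum_eq_single j (fun i _ h => by simp [Pi.single_eq_of_ne h]) (by simp)]
    simp
  simp only [h1] at key
  rw [key, Finset.sum_eq_single j (fun i _ h => by simp [Pi.single_eq_of_ne h]) (by simp)]
  simp

/-! ### Fourier series of smooth functions on the torus. -/

section Fourier

variable {n : ℕ}

/-- The partial derivative `∂u/∂y_j` on `C^∞(𝕋ⁿ)`. -/
def SmoothTorus.partialDeriv (j : Fin n) (u : SmoothTorus n) : SmoothTorus n :=
  SmoothTorus.mk (fun y => fderiv ℝ u y (Pi.single j 1))
    ((u.contDiff.fderiv_right (m := ∞) (by simp)).clm_apply contDiff_const)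
    (by
      intro y k
      have h : (fun z => u (z + fun i => 2 * π * (k i : ℝ))) = u := funext fun z => u.periodic z k
      have h2 := fderiv_comp_add_right (𝕜 := ℝ) (f := u) (x := y) (fun i => 2 * π * (k i : ℝ))
      rw [h] at h2
      have h3 : (fun i => y i + 2 * π * (k i : ℝ)) = y + fun i => 2 * π * (k i : ℝ) := rfl
      rw [h3, ← h2])

theorem SmoothTorus.partialDeriv_apply (j : Fin n) (u : SmoothTorus n) (y : Fin n → ℝ) :
    u.partialDeriv j y = fderiv ℝ u y (Pi.single j 1) := rfl

/-- The covering of the torus `ℝⁿ / ℤⁿ`. -/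
def torusMk (n : ℕ) : C(Fin n → ℝ, UnitAddTorus (Fin n)) where
  toFun x i := (x i : UnitAddCircle)
  continuous_toFun := by fun_prop

theorem isQuotientMap_torusMk (n : ℕ) : IsQuotientMap (torusMk n) :=
  (IsOpenQuotientMap.piMap (f := fun (_ : Fin n) (x : ℝ) => (x : UnitAddCircle))
    fun _ => QuotientAddGroup.isOpenQuotientMap_mk).isQuotientMap

theorem torusMk_eq_iff {x y : Fin n → ℝ} :
    torusMk n x = torusMk n y ↔ ∃ k : Fin n → ℤ, x = fun i => y i + k i := by
  rw [funext_iff]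
  have : ∀ i, torusMk n x i = torusMk n y i ↔ ∃ k : ℤ, x i = y i + k := by
    intro i
    change (x i : UnitAddCircle) = (y i : UnitAddCircle) ↔ _
    rw [← sub_eq_zero, ← AddCircle.coe_sub, AddCircle.coe_eq_zero_iff]
    refine exists_congr fun k => ?_
    rw [zsmul_one, eq_sub_iff_add_eq, eq_comm, add_comm]
  simp only [this, funext_iff]
  exact Classical.skolem

/-- The function `x ↦ u (2π x)`. -/
def SmoothTorus.rescale (u : SmoothTorus n) : C(Fin n → ℝ, ℂ) :=
  ⟨fun x => u ((2 * π) • x), u.contDiff.continuous.comp (by fun_prop)⟩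

theorem SmoothTorus.factorsThrough_rescale (u : SmoothTorus n) :
    Function.FactorsThrough u.rescale (torusMk n) := by
  intro x y h
  obtain ⟨k, rfl⟩ := torusMk_eq_iff.1 h
  simp only [SmoothTorus.rescale, ContinuousMap.coe_mk]
  rw [← u.periodic ((2 * π) • y) k]
  congr 1
  funext i
  simp [mul_add]

/-- A smooth function on the torus as a continuous function on `ℝⁿ / ℤⁿ`. -/
def SmoothTorus.toUnit (u : SmoothTorus n) : C(UnitAddTorus (Fin n), ℂ) :=
  (isQuotientMap_torusMk n).lift u.rescale u.factorsThrough_rescale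

theorem SmoothTorus.toUnit_torusMk (u : SmoothTorus n) (x : Fin n → ℝ) :
    u.toUnit (torusMk n x) = u ((2 * π) • x) :=
  DFunLike.congr_fun ((isQuotientMap_torusMk n).lift_comp u.rescale u.factorsThrough_rescale) x

theorem expo_apply (η : Fin n → ℤ) (y : Fin n → ℝ) :
    expo η y = Complex.exp (Complex.I * (dot y η : ℝ)) := rfl

theorem norm_expo (η : Fin n → ℤ) (y : Fin n → ℝ) : ‖expo η y‖ = 1 := by
  rw [expo_apply, mul_comm, Complex.norm_exp_ofReal_mul_I]

theorem mFourier_torusMk (η : Fin n → ℤ) (x : Fin n → ℝ) :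
    UnitAddTorus.mFourier η (torusMk n x) = expo η ((2 * π) • x) := by
  have : UnitAddTorus.mFourier η (torusMk n x) =
      ∏ i, fourier (η i) (x i : UnitAddCircle) := rfl
  rw [this, expo_apply, dot]
  simp only [fourier_coe_apply]
  rw [← Complex.exp_sum]
  congr 1
  push_cast
  rw [Finset.mul_sum]
  refine Finset.sum_congr rfl fun i _ => ?_
  simp
  ring

/-- The Fourier coefficients of a smooth function on the torus. -/
def SmoothTorus.coeff (u : SmoothTorus n) (η : Fin n → ℤ) : ℂ :=
  UnitAddTorus.mFourierCoeff u.toUnit η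

theorem SmoothTorus.coeff_eq_integral (u : SmoothTorus n) (η : Fin n → ℤ) :
    u.coeff η = ∫ x in Icc (0 : Fin n → ℝ) 1, expo (-η) ((2 * π) • x) * u ((2 * π) • x) := by
  rw [SmoothTorus.coeff, UnitAddTorus.mFourierCoeff_eq_integral _ _ 0]
  have h : {x : Fin n → ℝ | ∀ i, x i ∈ Ioc ((0 : Fin n → ℝ) i) ((0 : Fin n → ℝ) i + 1)} =
      Set.pi univ fun i => Ioc ((0 : Fin n → ℝ) i) ((1 : Fin n → ℝ) i) := by
    ext x
    simp
  rw [h, setIntegral_congr_set (t := Icc (0 : Fin n → ℝ) 1)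
    (by rw [volume_pi]; exact Measure.univ_pi_Ioc_ae_eq_Icc)]
  refine integral_congr_ae (Eventually.of_forall fun x => ?_)
  have h1 := mFourier_torusMk (-η) x
  have h2 := u.toUnit_torusMk x
  simp only [smul_eq_mul]
  rw [← h1, ← h2]
  rfl

theorem SmoothTorus.norm_coeff_le (u : SmoothTorus n) {K : ℝ} (hK : ∀ y, ‖u y‖ ≤ K)
    (η : Fin n → ℤ) : ‖u.coeff η‖ ≤ K := by
  rw [u.coeff_eq_integral]
  refine (norm_setIntegral_le_of_norm_le_const (C := K) isCompact_Icc.measure_lt_top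
    fun x _ => ?_).trans ?_
  · rw [norm_mul, norm_expo, one_mul]
    exact hK _
  · have : volume.real (Icc (0 : Fin n → ℝ) 1) = 1 := by
      rw [Measure.real, Real.volume_Icc_pi]
      simp
    rw [this, mul_one]

theorem contDiff_dot (η : Fin n → ℤ) : ContDiff ℝ ∞ fun y : Fin n → ℝ => dot y η := by
  unfold dot
  fun_prop

theorem hasFDerivAt_dot (η : Fin n → ℤ) (y : Fin n → ℝ) :
    HasFDerivAt (fun y => dot y η)
      (∑ i, (η i : ℝ) • (ContinuousLinearMap.proj i : (Fin n → ℝ) →L[ℝ] ℝ)) y := by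
  unfold dot
  refine HasFDerivAt.fun_sum fun i _ => ?_
  exact (ContinuousLinearMap.proj (R := ℝ) (φ := fun _ : Fin n => ℝ) i).hasFDerivAt.mul_const _

theorem fderiv_expo (η : Fin n → ℤ) (y : Fin n → ℝ) (j : Fin n) :
    fderiv ℝ (expo η) y (Pi.single j 1) = Complex.I * η j * expo η y := by
  have h1 : HasFDerivAt (fun y => Complex.I * (dot y η : ℝ))
      (Complex.I • Complex.ofRealCLM.comp
        (∑ i, (η i : ℝ) • (ContinuousLinearMap.proj i : (Fin n → ℝ) →L[ℝ] ℝ))) y :=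
    (Complex.ofRealCLM.hasFDerivAt.comp y (hasFDerivAt_dot η y)).const_mul _
  have h2 : HasFDerivAt (expo η) _ y := h1.cexp
  rw [h2.fderiv]
  simp [Pi.single_apply, expo_apply]
  ring

/-- Integrate the j-th derivative of e^{-iy·η} u over a period cell: opposite faces cancel by
periodicity. -/
theorem SmoothTorus.coeff_partialDeriv (u : SmoothTorus n) (j : Fin n) (η : Fin n → ℤ) :
    (u.partialDeriv j).coeff η = Complex.I * η j * u.coeff η := by
  obtain _ | n := n
  · exact j.elim0
  set F : (Fin (n + 1) → ℝ) → ℂ := fun y => expo (-η) y * u y with hF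
  have hFs : ContDiff ℝ ∞ F := (expo (-η)).contDiff.mul u.contDiff
  have hFd : ∀ y, fderiv ℝ F y (Pi.single j 1) =
      expo (-η) y * u.partialDeriv j y - Complex.I * η j * (expo (-η) y * u y) := by
    intro y
    have h1 := ((expo (-η)).contDiff.differentiable (by simp) y).hasFDerivAt.mul
      (u.contDiff.differentiable (by simp) y).hasFDerivAt
    have h2 : fderiv ℝ F y = _ := h1.fderiv
    rw [h2]
    change expo (-η) y * fderiv ℝ u y (Pi.single j 1) +
      u y * fderiv ℝ (expo (-η)) y (Pi.single j 1) = _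
    rw [fderiv_expo, SmoothTorus.partialDeriv_apply, Pi.neg_apply]
    push_cast
    ring
  have hzero : ∫ x in Icc (0 : Fin (n + 1) → ℝ) 1,
      fderiv ℝ (fun x => F ((2 * π) • x)) x (Pi.single j 1) = 0 := by
    rw [integral_Icc_partialDeriv zero_le_one j
      (f := fun x => F ((2 * π) • x))
      ((hFs.comp (contDiff_const_smul _)).of_le (mod_cast le_top)), sub_eq_zero]
    refine integral_congr_ae (Eventually.of_forall fun x => ?_)
    have hk : ((2 * π) • (j.insertNth ((1 : Fin (n + 1) → ℝ) j) x : Fin (n + 1) → ℝ)) =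
        fun i => ((2 * π) • (j.insertNth ((0 : Fin (n + 1) → ℝ) j) x : Fin (n + 1) → ℝ)) i +
          2 * π * ((Pi.single j 1 : Fin (n + 1) → ℤ) i : ℝ) := by
      funext i
      refine Fin.succAboveCases j ?_ (fun i => ?_) i <;> simp
    simp only [hF]
    rw [hk, SmoothTorus.periodic, SmoothTorus.periodic]
  have h3 : ∀ x, fderiv ℝ (fun x => F ((2 * π) • x)) x (Pi.single j 1) =
      (2 * π : ℝ) * (expo (-η) ((2 * π) • x) * u.partialDeriv j ((2 * π) • x)) -
        (2 * π : ℝ) * (Complex.I * η j) * (expo (-η) ((2 * π) • x) * u ((2 * π) • x)) := by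
    intro x
    rw [fderiv_comp_smul]
    change (2 * π) • fderiv ℝ F ((2 * π) • x) (Pi.single j 1) = _
    rw [hFd, Complex.real_smul]
    ring
  simp only [h3] at hzero
  have hint : ∀ v : SmoothTorus (n + 1), IntegrableOn
      (fun x => expo (-η) ((2 * π) • x) * v ((2 * π) • x)) (Icc 0 1) := fun v =>
    (((expo (-η)).contDiff.continuous.comp (continuous_const_smul _)).mul
      (v.contDiff.continuous.comp (continuous_const_smul _))).integrableOn_Icc
  rw [integral_sub ((hint _).const_mul _) ((hint _).const_mul _), integral_const_mul,
    integral_const_mul, ← u.coeff_eq_integral, ← SmoothTorus.coeff_eq_integral] at hzero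
  have hpi : ((2 * π : ℝ) : ℂ) ≠ 0 := by
    rw [Complex.ofReal_ne_zero]
    positivity
  rw [mul_assoc, ← mul_sub, mul_eq_zero, or_iff_right hpi, sub_eq_zero] at hzero
  exact hzero

theorem SmoothTorus.coeff_iterate_partialDeriv (u : SmoothTorus n) (j : Fin n) (k : ℕ)
    (η : Fin n → ℤ) :
    ((SmoothTorus.partialDeriv j)^[k] u).coeff η = (Complex.I * η j) ^ k * u.coeff η := by
  induction k generalizing u with
  | zero => simp
  | succ k ih => rw [Function.iterate_succ_apply, ih, SmoothTorus.coeff_partialDeriv]; ring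

/-- The Fourier coefficients of a smooth function decrease rapidly. -/
theorem SmoothTorus.exists_coeff_bound (u : SmoothTorus n) (k : ℕ) :
    ∃ K : ℝ, 0 ≤ K ∧ ∀ η : Fin n → ℤ, (1 + ∑ i, |(η i : ℝ)|) ^ k * ‖u.coeff η‖ ≤ K := by
  have hj : ∀ j : Fin n, ∃ K : ℝ, ∀ η : Fin n → ℤ, |(η j : ℝ)| ^ k * ‖u.coeff η‖ ≤ K := by
    intro j
    obtain ⟨K, hK⟩ := ((SmoothTorus.partialDeriv j)^[k] u).exists_bound
    refine ⟨K, fun η => ?_⟩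
    have := SmoothTorus.norm_coeff_le _ hK η
    rw [u.coeff_iterate_partialDeriv, norm_mul, norm_pow, norm_mul, Complex.norm_I, one_mul,
      Complex.norm_intCast] at this
    exact this
  choose K hK using hj
  obtain ⟨K0, hK0⟩ := u.exists_bound
  have hK0' : 0 ≤ K0 := (norm_nonneg _).trans (hK0 0)
  have hK' : ∀ j, 0 ≤ K j := fun j => le_trans (by positivity) (hK j 0)
  refine ⟨(n + 1 : ℝ) ^ k * (K0 + ∑ j, K j),
    mul_nonneg (by positivity) (add_nonneg hK0' (Finset.sum_nonneg fun j _ => hK' j)),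
    fun η => ?_⟩
  -- Here t is the larger of 1 and the maximum of the |η i|; the decay comes from the coordinate
  -- where that maximum is attained.
  have hmax : ∃ t : ℝ, 0 ≤ t ∧ (1 + ∑ i, |(η i : ℝ)|) ≤ (n + 1) * t ∧
      t ^ k * ‖u.coeff η‖ ≤ K0 + ∑ j, K j := by
    by_cases h : ∀ i, |(η i : ℝ)| ≤ 1
    · refine ⟨1, zero_le_one, ?_, ?_⟩
      · have := Finset.sum_le_sum fun i (_ : i ∈ Finset.univ) => h i
        simp only [Finset.sum_const, Finset.card_univ, Fintype.card_fin, nsmul_eq_mul] at this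
        linarith
      · rw [one_pow, one_mul]
        exact (u.norm_coeff_le hK0 η).trans
          (le_add_of_nonneg_right (Finset.sum_nonneg fun j _ => hK' j))
    · push Not at h
      obtain ⟨i0, hi0⟩ := h
      obtain ⟨j, -, hj⟩ := Finset.exists_max_image Finset.univ (fun i => |(η i : ℝ)|)
        ⟨i0, Finset.mem_univ _⟩
      refine ⟨|(η j : ℝ)|, abs_nonneg _, ?_, ?_⟩
      · have h2 := Finset.sum_le_sum fun i (hi : i ∈ Finset.univ) => hj i hi
        simp only [Finset.sum_const, Finset.card_univ, Fintype.card_fin, nsmul_eq_mul] at h2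
        have h3 := hj i0 (Finset.mem_univ _)
        linarith
      · exact (hK j η).trans ((Finset.single_le_sum (fun j _ => hK' j) (Finset.mem_univ j)).trans
          (le_add_of_nonneg_left hK0'))
  obtain ⟨t, ht0, ht1, ht2⟩ := hmax
  calc (1 + ∑ i, |(η i : ℝ)|) ^ k * ‖u.coeff η‖ ≤ ((n + 1) * t) ^ k * ‖u.coeff η‖ := by
        gcongr
    _ = (n + 1 : ℝ) ^ k * (t ^ k * ‖u.coeff η‖) := by rw [mul_pow]; ring
    _ ≤ _ := by gcongr

theorem summable_prod_of_summable {f : ℤ → ℝ} (hf : Summable f) (h0 : ∀ k, 0 ≤ f k) (n : ℕ) :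
    Summable fun η : Fin n → ℤ => ∏ i, f (η i) := by
  induction n with
  | zero => exact (hasSum_fintype _).summable
  | succ n ih =>
    rw [← (Fin.consEquiv fun _ : Fin (n + 1) => ℤ).summable_iff]
    have := hf.mul_of_nonneg ih h0 (fun η => Finset.prod_nonneg fun i _ => h0 _)
    refine this.congr fun x => ?_
    simp [Fin.consEquiv, Fin.prod_univ_succ]

/-- The exponent 2n allows a comparison with the product of the one-variable series ∑ (1 +
|k|)^{-2}. -/
theorem summable_inv_one_add_sum_abs_pow (n : ℕ) :
    Summable fun η : Fin n → ℤ => ((1 + ∑ i, |(η i : ℝ)|) ^ (2 * n))⁻¹ := by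
  have h1 : Summable fun k : ℤ => ((1 + |(k : ℝ)|) ^ 2)⁻¹ := by
    refine Summable.of_norm_bounded_eventually (g := fun k : ℤ => 1 / (k : ℝ) ^ 2)
      (Real.summable_one_div_int_pow.2 one_lt_two) ?_
    have : ∀ᶠ k : ℤ in cofinite, k ≠ 0 := (Set.finite_singleton (0 : ℤ)).eventually_cofinite_notMem
    filter_upwards [this] with k hk
    have hk' : 0 < |(k : ℝ)| := by positivity
    rw [norm_inv, norm_pow, Real.norm_of_nonneg (by positivity), one_div, ← sq_abs (k : ℝ)]
    gcongr
    linarith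
  refine Summable.of_nonneg_of_le (fun η => by positivity) (fun η => ?_)
    (summable_prod_of_summable h1 (fun k => by positivity) n)
  rw [Finset.prod_inv_distrib, Finset.prod_pow, pow_mul, pow_right_comm]
  have hpos : 0 < ∏ i, (1 + |(η i : ℝ)|) := Finset.prod_pos fun i _ => by positivity
  gcongr
  · refine (Finset.prod_le_prod (g := fun _ => 1 + ∑ i, |(η i : ℝ)|)
      (fun i _ => by positivity) fun i _ => ?_).trans (by simp)
    gcongr
    exact Finset.single_le_sum (f := fun i => |(η i : ℝ)|) (fun i _ => abs_nonneg _)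
      (Finset.mem_univ i)

theorem exists_bound_iteratedFDeriv_dot (n i : ℕ) : ∃ K : ℝ, 0 ≤ K ∧
    ∀ (η : Fin n → ℤ) (y : Fin n → ℝ),
      ‖iteratedFDeriv ℝ (i + 1) (fun y => Complex.I * (dot y η : ℝ)) y‖
        ≤ K * ∑ j, |(η j : ℝ)| := by
  have hs : ∀ j : Fin n, ContDiff ℝ ∞ (fun y : Fin n → ℝ => Complex.I * (y j : ℂ)) := fun j =>
    contDiff_const.mul (Complex.ofRealCLM.contDiff.comp (contDiff_apply ℝ ℝ j))
  have h1 : ∀ j : Fin n, ∃ K : ℝ, ∀ y,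
      ‖iteratedFDeriv ℝ (i + 1) (fun y : Fin n → ℝ => Complex.I * (y j : ℂ)) y‖ ≤ K := fun j =>
    exists_bound_iteratedFDeriv_of_quasiperiodic (hs j)
      (fun k => ⟨Complex.I * (2 * π * k j), fun y => by push_cast; ring⟩) i
  choose K hK using h1
  have hK' : ∀ j, 0 ≤ K j := fun j => (norm_nonneg _).trans (hK j 0)
  refine ⟨∑ j, K j, Finset.sum_nonneg fun j _ => hK' j, fun η y => ?_⟩
  have h2 : (fun y => Complex.I * (dot y η : ℝ)) =
      fun y => ∑ j, (η j : ℝ) • (Complex.I * (y j : ℂ)) := by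
    funext y
    simp only [dot, Complex.real_smul]
    push_cast
    rw [Finset.mul_sum]
    exact Finset.sum_congr rfl fun j _ => by ring
  rw [h2, iteratedFDeriv_sum fun j _ => ((hs j).const_smul (η j : ℝ)).of_le (mod_cast le_top),
    Finset.sum_apply, Finset.mul_sum]
  refine (norm_sum_le _ _).trans (Finset.sum_le_sum fun j _ => ?_)
  rw [iteratedFDeriv_const_smul_apply' ((hs j).of_le (mod_cast le_top)).contDiffAt, norm_smul,
    Real.norm_eq_abs, mul_comm]
  gcongr
  exact (hK j y).trans (Finset.single_le_sum (fun j _ => hK' j) (Finset.mem_univ j))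

theorem exists_bound_iteratedFDeriv_expo (n k : ℕ) : ∃ K : ℝ, 0 ≤ K ∧
    ∀ (η : Fin n → ℤ) (y : Fin n → ℝ),
      ‖iteratedFDeriv ℝ k (expo η) y‖ ≤ K * (1 + ∑ j, |(η j : ℝ)|) ^ k := by
  choose K hK0 hK using exists_bound_iteratedFDeriv_dot n
  set L : ℝ := 1 + ∑ i ∈ Finset.range k, K i
  have hL : 1 ≤ L := le_add_of_nonneg_right (Finset.sum_nonneg fun i _ => hK0 i)
  refine ⟨k.factorial * L ^ k, by positivity, fun η y => ?_⟩
  have hS : 0 ≤ ∑ j, |(η j : ℝ)| := Finset.sum_nonneg fun i _ => abs_nonneg _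
  have h1 : ContDiff ℝ ∞ (fun y : Fin n → ℝ => Complex.I * (dot y η : ℝ)) := by
    exact contDiff_const.mul (Complex.ofRealCLM.contDiff.comp (contDiff_dot η))
  refine (norm_iteratedFDeriv_cexp_comp_le h1 k y (D := L * (1 + ∑ j, |(η j : ℝ)|))
    (by nlinarith) ?_).trans ?_
  · rintro (_ | i) hi hik
    · omega
    refine (hK i η y).trans ?_
    gcongr
    · exact (Finset.single_le_sum (f := K) (fun i _ => hK0 i) (Finset.mem_range.2 hik)).trans
        (le_add_of_nonneg_left zero_le_one)
    · linarith
  · have := norm_expo η y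
    rw [expo_apply] at this
    rw [this, mul_one, mul_pow, mul_assoc]

/-- The Fourier series of a smooth function converges in `C^∞(𝕋ⁿ)`. -/
theorem SmoothTorus.hasSum_coeff_smul_expo (u : SmoothTorus n) :
    HasSum (fun η => u.coeff η • expo η) u := by
  choose K hK0 hK using exists_bound_iteratedFDeriv_expo n
  -- Of the decay exponent, k absorbs the derivatives of the exponential and 2n ensures summability
  -- over the lattice.
  choose L hL0 hL using fun k => u.exists_coeff_bound (k + 2 * n)
  have hmain : ∀ k (η : Fin n → ℤ),
      ‖u.coeff η‖ * (1 + ∑ j, |(η j : ℝ)|) ^ k ≤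
        L k * ((1 + ∑ i, |(η i : ℝ)|) ^ (2 * n))⁻¹ := by
    intro k η
    have hpos : 0 < 1 + ∑ i, |(η i : ℝ)| := by positivity
    rw [← div_eq_mul_inv, le_div_iff₀ (by positivity), mul_assoc, ← pow_add, mul_comm]
    exact hL k η
  obtain ⟨g, hg, -⟩ := SmoothTorus.exists_hasSum (fun η => u.coeff η • expo η)
    (fun k η => K k * (L k * ((1 + ∑ i, |(η i : ℝ)|) ^ (2 * n))⁻¹))
    (fun k => ((summable_inv_one_add_sum_abs_pow n).mul_left _).mul_left _) (by
      intro k η y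
      have h : ((u.coeff η • expo η : SmoothTorus n) : (Fin n → ℝ) → ℂ) =
        u.coeff η • (expo η : (Fin n → ℝ) → ℂ) := rfl
      rw [h, iteratedFDeriv_const_smul_apply ((expo η).contDiff.of_le (mod_cast le_top)).contDiffAt,
        norm_smul]
      refine (mul_le_mul_of_nonneg_left (hK k η y) (norm_nonneg _)).trans ?_
      rw [mul_left_comm]
      exact mul_le_mul_of_nonneg_left (hmain k η) (hK0 k))
  have hsum : Summable (UnitAddTorus.mFourierCoeff u.toUnit) := by
    refine Summable.of_norm_bounded ((summable_inv_one_add_sum_abs_pow n).mul_left (L 0))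
      fun η => ?_
    have := hmain 0 η
    rwa [pow_zero, mul_one] at this
  -- The series converges in C^∞ to some g; pointwise Fourier inversion identifies g with u.
  suffices g = u by rwa [this] at hg
  ext y
  have h1 := UnitAddTorus.hasSum_mFourier_series_apply_of_summable hsum
    (torusMk n ((2 * π)⁻¹ • y))
  have h2 : (2 * π) • (2 * π)⁻¹ • y = y := smul_inv_smul₀ (by positivity) y
  simp only [SmoothTorus.toUnit_torusMk, mFourier_torusMk, h2] at h1
  exact (SmoothTorus.hasSum_apply hg y).unique h1

end Fourier

/-! ### Functions with a single frequency in x. -/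

section Wave

variable {N : ℕ}

/-- The function `(t, x) ↦ h(t) e^{i x · ξ}`. -/
def wave (h : ℝ → ℂ) (ξ : Fin N → ℤ) (y : Fin (N + 1) → ℝ) : ℂ :=
  h (y 0) * Complex.exp (Complex.I * (dot (Fin.tail y) ξ : ℝ))

theorem wave_mul_wave (h h' : ℝ → ℂ) (ξ ξ' : Fin N → ℤ) (y : Fin (N + 1) → ℝ) :
    wave h ξ y * wave h' ξ' y = wave (fun t => h t * h' t) (ξ + ξ') y := by
  have : dot (Fin.tail y) (ξ + ξ') = dot (Fin.tail y) ξ + dot (Fin.tail y) ξ' := by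
    simp [dot, mul_add, Finset.sum_add_distrib]
  simp only [wave, this]
  push_cast
  rw [mul_add, Complex.exp_add]
  ring

theorem wave_zero (h : ℝ → ℂ) (y : Fin (N + 1) → ℝ) : wave h 0 y = h (y 0) := by
  simp [wave, dot]

theorem norm_wave (h : ℝ → ℂ) (ξ : Fin N → ℤ) (y : Fin (N + 1) → ℝ) :
    ‖wave h ξ y‖ = ‖h (y 0)‖ := by
  rw [wave, norm_mul, mul_comm Complex.I, Complex.norm_exp_ofReal_mul_I, mul_one]

theorem expo_eq_wave (η : Fin (N + 1) → ℤ) (y : Fin (N + 1) → ℝ) :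
    expo η y = wave (fun t => Complex.exp (Complex.I * (t * η 0))) (Fin.tail η) y := by
  rw [expo_apply, wave, ← Complex.exp_add, dot, Fin.sum_univ_succ]
  congr 1
  push_cast
  rw [mul_add]
  simp [dot, Fin.tail]

theorem hasFDerivAt_wave {h : ℝ → ℂ} {h' : ℂ} (ξ : Fin N → ℤ) {y : Fin (N + 1) → ℝ}
    (hh : HasDerivAt h h' (y 0)) :
    HasFDerivAt (wave h ξ)
      ((Complex.exp (Complex.I * (dot (Fin.tail y) ξ : ℝ))) •
          ((ContinuousLinearMap.proj 0 : (Fin (N + 1) → ℝ) →L[ℝ] ℝ).smulRight h') +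
        (Complex.I * wave h ξ y) • Complex.ofRealCLM.comp
          (∑ i, (ξ i : ℝ) • (ContinuousLinearMap.proj i.succ : (Fin (N + 1) → ℝ) →L[ℝ] ℝ))) y := by
  have h1 : HasFDerivAt (fun z : Fin (N + 1) → ℝ => h (z 0)) _ y :=
    hh.hasFDerivAt.comp y (ContinuousLinearMap.proj (R := ℝ) (φ := fun _ : Fin (N + 1) => ℝ) 0).hasFDerivAt
  have h2 : HasFDerivAt (fun z : Fin (N + 1) → ℝ => dot (Fin.tail z) ξ)
      (∑ i, (ξ i : ℝ) • (ContinuousLinearMap.proj i.succ : (Fin (N + 1) → ℝ) →L[ℝ] ℝ)) y := by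
    unfold dot
    refine HasFDerivAt.fun_sum fun i _ => ?_
    exact (ContinuousLinearMap.proj (R := ℝ) (φ := fun _ : Fin (N + 1) => ℝ) i.succ).hasFDerivAt.mul_const _
  have h3 := h1.mul ((Complex.ofRealCLM.hasFDerivAt.comp y h2).const_mul Complex.I).cexp
  refine h3.congr_fderiv ?_
  ext v
  simp [wave]
  ring

theorem fderiv_wave_succ {h : ℝ → ℂ} (hh : Differentiable ℝ h) (ξ : Fin N → ℤ)
    (y : Fin (N + 1) → ℝ) (j : Fin N) :
    fderiv ℝ (wave h ξ) y (Pi.single j.succ 1) = Complex.I * ξ j * wave h ξ y := by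
  rw [(hasFDerivAt_wave ξ (hh (y 0)).hasDerivAt).fderiv]
  simp [Pi.single_apply]
  ring

theorem fderiv_wave_zero {h h' : ℝ → ℂ} (hh : ∀ t, HasDerivAt h (h' t) t) (ξ : Fin N → ℤ)
    (y : Fin (N + 1) → ℝ) :
    fderiv ℝ (wave h ξ) y (Pi.single 0 1) = wave h' ξ y := by
  rw [(hasFDerivAt_wave ξ (hh (y 0))).fderiv]
  simp [wave]
  ring

theorem contDiff_wave {h : ℝ → ℂ} (hh : ContDiff ℝ ∞ h) (ξ : Fin N → ℤ) :
    ContDiff ℝ ∞ (wave h ξ) := by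
  refine (hh.comp (contDiff_apply ℝ ℝ 0)).mul (contDiff_const.mul
    (Complex.ofRealCLM.contDiff.comp ((contDiff_dot ξ).comp ?_))).cexp
  exact contDiff_pi.2 fun i => contDiff_apply ℝ ℝ i.succ

theorem wave_periodic {h : ℝ → ℂ} (hh : ∀ (t : ℝ) (k : ℤ), h (t + 2 * π * k) = h t)
    (ξ : Fin N → ℤ) (y : Fin (N + 1) → ℝ) (k : Fin (N + 1) → ℤ) :
    wave h ξ (fun i => y i + 2 * π * (k i : ℝ)) = wave h ξ y := by
  simp only [wave, hh]
  congr 1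
  exact (expo ξ).periodic (Fin.tail y) (Fin.tail k)

/-- The box `[p, q] × [0, 2π]^N`. -/
def slab (N : ℕ) (p q : ℝ) : Set (Fin (N + 1) → ℝ) :=
  Icc (Fin.cons p 0) (Fin.cons q fun _ => 2 * π)

theorem cons_le_cons {p q : ℝ} (hpq : p ≤ q) :
    (Fin.cons p 0 : Fin (N + 1) → ℝ) ≤ Fin.cons q fun _ => 2 * π :=
  Fin.cons_le_cons.2 ⟨hpq, fun _ => by simp only [Pi.zero_apply]; positivity⟩

/-- If ξ j ≠ 0, the wave is a multiple of its own derivative in x_j, whose integral vanishes by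
periodicity in x_j. No periodicity in t is needed, so [p, q] may be any interval. -/
theorem integral_slab_wave {p q : ℝ} (hpq : p ≤ q) {h : ℝ → ℂ} (hh : ContDiff ℝ ∞ h)
    {ξ : Fin N → ℤ} (hξ : ξ ≠ 0) : ∫ y in slab N p q, wave h ξ y = 0 := by
  obtain ⟨j, hj⟩ := Function.ne_iff.1 hξ
  have h1 := integral_Icc_partialDeriv (cons_le_cons hpq) j.succ
    ((contDiff_wave hh ξ).of_le (mod_cast le_top))
  rw [integral_congr_ae (Eventually.of_forall fun y =>
    fderiv_wave_succ (hh.differentiable (by simp)) ξ y j), integral_const_mul] at h1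
  rw [sub_eq_zero.2 (integral_congr_ae (Eventually.of_forall fun x => ?_)), mul_eq_zero,
    or_iff_right] at h1
  · exact h1
  · simpa using hj
  · obtain _ | N := N
    · exact j.elim0
    have h0 : ∀ s : ℝ, (j.succ.insertNth s x : Fin (N + 1 + 1) → ℝ) 0 = x 0 := by
      intro s
      have : (0 : Fin (N + 1 + 1)) = j.succ.succAbove 0 := by simp
      rw [this, Fin.insertNth_apply_succAbove]
    have ht : (Fin.tail (j.succ.insertNth (2 * π) x : Fin (N + 1 + 1) → ℝ)) = fun i =>
        (Fin.tail (j.succ.insertNth (0 : ℝ) x : Fin (N + 1 + 1) → ℝ)) i +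
          2 * π * ((Pi.single j 1 : Fin (N + 1) → ℤ) i : ℝ) := by
      funext i
      simp only [Fin.tail]
      by_cases hi : i = j
      · subst hi
        simp
      · obtain ⟨l, hl⟩ := Fin.exists_succAbove_eq (fun h => hi (Fin.succ_injective _ h) : i.succ ≠ j.succ)
        rw [← hl]
        simp [hi]
    simp only [wave, Fin.cons_succ, Pi.zero_apply, h0, ht]
    congr 1
    exact (expo ξ).periodic _ (Pi.single j 1)

end Wave

/-! ### Action of Q on waves, and integration by parts for P. -/

section Operator

variable {N : ℕ} {Q : SmoothTorus (N + 1) →L[ℂ] SmoothTorus (N + 1)} {c : ℝ → (Fin N → ℤ) → ℂ}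

theorem HasTubeSymbol.apply_expo (hc : HasTubeSymbol Q c) (η : Fin (N + 1) → ℤ)
    (y : Fin (N + 1) → ℝ) : Q (expo η) y = c (y 0) (Fin.tail η) * expo η y := by
  rw [← hc, discreteSymbol, expo_apply, mul_right_comm, ← Complex.exp_add, neg_add_cancel,
    Complex.exp_zero, one_mul]

/-- The symbol inherits smoothness from Q: it is the restriction to x = 0 of Q(e^{ix·ξ}). -/
theorem HasTubeSymbol.contDiff (hc : HasTubeSymbol Q c) (ξ : Fin N → ℤ) :
    ContDiff ℝ ∞ fun t => c t ξ := by
  have h1 : ∀ t : ℝ, c t ξ = Q (expo (Fin.cons 0 ξ)) (Fin.cons t 0) := by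
    intro t
    rw [hc.apply_expo, expo_apply]
    simp [dot, Fin.sum_univ_succ]
  simp only [h1]
  refine (Q (expo (Fin.cons 0 ξ))).contDiff.comp (contDiff_pi.2 fun i => ?_)
  refine Fin.cases ?_ (fun i => ?_) i
  · simpa using contDiff_fun_id
  · simpa using contDiff_const

theorem HasTubeSymbol.periodic (hc : HasTubeSymbol Q c) (ξ : Fin N → ℤ) (t : ℝ) (k : ℤ) :
    c (t + 2 * π * k) ξ = c t ξ := by
  have h1 : ∀ t : ℝ, c t ξ = Q (expo (Fin.cons 0 ξ)) (Fin.cons t 0) := by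
    intro t
    rw [hc.apply_expo, expo_apply]
    simp [dot, Fin.sum_univ_succ]
  rw [h1, h1, ← SmoothTorus.periodic _ (Fin.cons t 0) (Fin.cons k 0)]
  congr 1
  funext i
  refine Fin.cases ?_ (fun i => ?_) i <;> simp

theorem hasSum_apply_expo (u : SmoothTorus (N + 1)) :
    HasSum (fun η => u.coeff η • Q (expo η)) (Q u) := by
  have := u.hasSum_coeff_smul_expo.map Q Q.continuous
  simpa only [Function.comp_def, map_smul] using this

/-- The operator `Q` acts on functions `h(t) e^{i x · ξ}` as multiplication by its symbol. -/
theorem HasTubeSymbol.apply_wave (hc : HasTubeSymbol Q c) {u : SmoothTorus (N + 1)} {h : ℝ → ℂ}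
    (hh : Differentiable ℝ h) {ξ : Fin N → ℤ} (hu : ∀ y, u y = wave h ξ y)
    (y : Fin (N + 1) → ℝ) : Q u y = c (y 0) ξ * u y := by
  -- Since ∂u/∂x_j = iξ_j u, comparing Fourier coefficients leaves only frequencies (τ, ξ), on which
  -- Q multiplies by the same c(t, ξ).
  have h0 : ∀ η, Fin.tail η ≠ ξ → u.coeff η = 0 := by
    intro η hη
    obtain ⟨j, hj⟩ := Function.ne_iff.1 hη
    have h1 : u.partialDeriv j.succ = (Complex.I * ξ j) • u := by
      ext y
      have hu' : (u : (Fin (N + 1) → ℝ) → ℂ) = wave h ξ := funext hu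
      rw [SmoothTorus.partialDeriv_apply, hu', fderiv_wave_succ hh, SmoothTorus.smul_apply, hu]
    have h2 := u.coeff_partialDeriv j.succ η
    have h3 : ((Complex.I * ξ j) • u).coeff η = (Complex.I * ξ j) * u.coeff η := by
      simp only [SmoothTorus.coeff_eq_integral, SmoothTorus.smul_apply, ← integral_const_mul]
      refine integral_congr_ae (Eventually.of_forall fun x => ?_)
      simp only
      ring
    rw [h1, h3, ← sub_eq_zero, ← sub_mul, mul_eq_zero, ← mul_sub, mul_eq_zero,
      or_iff_right Complex.I_ne_zero, sub_eq_zero, Int.cast_inj] at h2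
    exact h2.resolve_left fun h => hj h.symm
  have h1 := SmoothTorus.hasSum_apply (hasSum_apply_expo (Q := Q) u) y
  have h2 := (SmoothTorus.hasSum_apply u.hasSum_coeff_smul_expo y).mul_left (c (y 0) ξ)
  refine h1.unique (h2.congr_fun fun η => ?_)
  simp only [SmoothTorus.smul_apply, hc.apply_expo]
  by_cases hη : Fin.tail η = ξ
  · rw [hη]
    ring
  · simp [h0 η hη]

/-- The symmetry of `Q` when integrated against `h(t) e^{-i x · ξ}` over a slab. -/
theorem HasTubeSymbol.integral_slab_mul_wave (hc : HasTubeSymbol Q c) {p q : ℝ} (hpq : p ≤ q)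
    (u : SmoothTorus (N + 1)) {h : ℝ → ℂ} (hh : ContDiff ℝ ∞ h) (ξ : Fin N → ℤ) :
    ∫ y in slab N p q, Q u y * wave h (-ξ) y =
      ∫ y in slab N p q, u y * wave (fun t => c t ξ * h t) (-ξ) y := by
  have hw := contDiff_wave hh (-ξ)
  have hw' := contDiff_wave ((hc.contDiff ξ).mul hh) (-ξ)
  have h1 := SmoothTorus.hasSum_integral (hasSum_apply_expo (Q := Q) u) hw.continuous
    (Fin.cons p 0) (Fin.cons q fun _ => 2 * π)
  have h2 := SmoothTorus.hasSum_integral u.hasSum_coeff_smul_expo hw'.continuous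
    (Fin.cons p 0) (Fin.cons q fun _ => 2 * π)
  refine h1.unique (h2.congr_fun fun η => ?_)
  simp only [SmoothTorus.smul_apply, hc.apply_expo, mul_assoc]
  rw [integral_const_mul, integral_const_mul]
  congr 1
  -- For a different x-frequency both integrals vanish, so it does not matter that the symbols c(t,
  -- ·) differ there.
  by_cases hη : Fin.tail η = ξ
  · refine integral_congr_ae (Eventually.of_forall fun y => ?_)
    simp only [hη, wave]
    ring
  · have hη' : Fin.tail η + -ξ ≠ 0 := by rwa [← sub_eq_add_neg, sub_ne_zero]
    have he : ContDiff ℝ ∞ fun t : ℝ => Complex.exp (Complex.I * (t * η 0)) :=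
      (contDiff_const.mul (Complex.ofRealCLM.contDiff.mul contDiff_const)).cexp
    have e1 := integral_slab_wave hpq (((hc.contDiff (Fin.tail η)).mul (he.mul hh))) hη'
    have e2 := integral_slab_wave hpq ((he.mul ((hc.contDiff ξ).mul hh))) hη'
    rw [slab] at e1 e2
    simp only [expo_eq_wave, wave_mul_wave]
    rw [e2, ← e1]
    refine integral_congr_ae (Eventually.of_forall fun y => ?_)
    simp only [wave]
    ring

theorem opP_apply (u : SmoothTorus (N + 1)) (y : Fin (N + 1) → ℝ) :
    opP Q u y = -Complex.I * fderiv ℝ u y (Pi.single 0 1) + Q u y := rfl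

theorem opP_add (u v : SmoothTorus (N + 1)) : opP Q (u + v) = opP Q u + opP Q v := by
  ext y
  have h : fderiv ℝ (u + v : SmoothTorus (N + 1)) y = fderiv ℝ u y + fderiv ℝ v y :=
    fderiv_add (u.contDiff.differentiable (by simp) y) (v.contDiff.differentiable (by simp) y)
  simp only [SmoothTorus.add_apply, opP_apply, h, map_add]
  rw [add_apply]
  ring

theorem sum_mem_range_opP {ι : Type*} (s : Finset ι) (v : ι → SmoothTorus (N + 1)) :
    ∑ i ∈ s, opP Q (v i) ∈ range (opP Q) := by
  classical
  refine ⟨∑ i ∈ s, v i, ?_⟩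
  induction s using Finset.induction_on with
  | empty =>
    have := opP_add (Q := Q) 0 0
    simpa using this
  | insert a s ha ih => rw [Finset.sum_insert ha, Finset.sum_insert ha, opP_add, ih]

/-- Integration by parts for `P` against `e^{i C(t)} e^{-i x · ξ}`, where `C' = c(·, ξ)`: only the
faces of the slab contribute. -/
theorem HasTubeSymbol.integral_slab_opP (hc : HasTubeSymbol Q c) {p q : ℝ} (hpq : p ≤ q)
    (u : SmoothTorus (N + 1)) (ξ : Fin N → ℤ) {C : ℝ → ℂ} (hCs : ContDiff ℝ ∞ C)
    (hC : ∀ t, HasDerivAt C (c t ξ) t) :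
    ∫ y in slab N p q, opP Q u y * wave (fun t => Complex.exp (Complex.I * C t)) (-ξ) y =
      -Complex.I * ((∫ x in Icc (0 : Fin N → ℝ) (fun _ => 2 * π), u (Fin.cons q x) *
          wave (fun t => Complex.exp (Complex.I * C t)) (-ξ) (Fin.cons q x)) -
        ∫ x in Icc (0 : Fin N → ℝ) (fun _ => 2 * π), u (Fin.cons p x) *
          wave (fun t => Complex.exp (Complex.I * C t)) (-ξ) (Fin.cons p x)) := by
  set h : ℝ → ℂ := fun t => Complex.exp (Complex.I * C t) with hh
  have hs : ContDiff ℝ ∞ h := (contDiff_const.mul hCs).cexp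
  have hd : ∀ t, HasDerivAt h (Complex.I * (c t ξ * h t)) t := by
    intro t
    have := ((hC t).const_mul Complex.I).cexp
    convert! this using 1
    simp only [hh]
    ring
  have hw := contDiff_wave hs (-ξ)
  have h1 := integral_Icc_partialDeriv (cons_le_cons (N := N) hpq) 0
    ((u.contDiff.mul hw).of_le (mod_cast le_top))
  have h2 : ∀ y, fderiv ℝ (fun y => u y * wave h (-ξ) y) y (Pi.single 0 1) =
      fderiv ℝ u y (Pi.single 0 1) * wave h (-ξ) y +
        Complex.I * (u y * wave (fun t => c t ξ * h t) (-ξ) y) := by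
    intro y
    have e : fderiv ℝ (fun y => u y * wave h (-ξ) y) y = _ :=
      ((u.contDiff.differentiable (by simp) y).hasFDerivAt.mul
        (hw.differentiable (by simp) y).hasFDerivAt).fderiv
    rw [e]
    change u y * fderiv ℝ (wave h (-ξ)) y (Pi.single 0 1) +
      wave h (-ξ) y * fderiv ℝ u y (Pi.single 0 1) = _
    rw [fderiv_wave_zero hd]
    simp only [wave]
    ring
  have hi1 : IntegrableOn (fun y => fderiv ℝ u y (Pi.single 0 1) * wave h (-ξ) y) (slab N p q) :=
    (u.partialDeriv 0).integrableOn_mul hw.continuous _ _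
  have hi2 : IntegrableOn (fun y => u y * wave (fun t => c t ξ * h t) (-ξ) y) (slab N p q) :=
    u.integrableOn_mul (contDiff_wave ((hc.contDiff ξ).mul hs) (-ξ)).continuous _ _
  have hi3 : IntegrableOn (fun y => Q u y * wave h (-ξ) y) (slab N p q) :=
    (Q u).integrableOn_mul hw.continuous _ _
  simp only [h2] at h1
  rw [← slab, integral_add hi1 (hi2.const_mul _), integral_const_mul] at h1
  simp only [Fin.insertNth_zero', Fin.cons_zero] at h1
  have ha : (Fin.cons p 0 : Fin (N + 1) → ℝ) ∘ Fin.succAbove 0 = 0 := by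
    funext i
    simp
  have hb : (Fin.cons q (fun _ => 2 * π) : Fin (N + 1) → ℝ) ∘ Fin.succAbove 0 =
      fun _ => 2 * π := by
    funext i
    simp
  rw [ha, hb] at h1
  rw [← h1]
  simp only [opP_apply, add_mul, mul_assoc]
  rw [integral_add (hi1.const_mul _) hi3, integral_const_mul,
    hc.integral_slab_mul_wave hpq u hs ξ, mul_add, ← mul_assoc (-Complex.I) Complex.I]
  simp

end Operator

/-! ### Disconnected sublevel sets on the circle. -/

section Circle

/-- If a sublevel set on the circle is disconnected, then two of its points are separated on both
arcs by points outside of it. -/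
theorem exists_separated_of_not_isPreconnected {F : ℝ → ℝ}
    (hF : ∀ (t : ℝ) (k : ℤ), F (t + 2 * π * k) = F t) {lam : ℝ}
    (h : ¬ IsPreconnected (circleSublevel F lam)) :
    ∃ a p b q : ℝ, a < p ∧ p < b ∧ b < q ∧ q < a + 2 * π ∧
      F a < lam ∧ lam ≤ F p ∧ F b < lam ∧ lam ≤ F q := by
  have hpi : (0 : ℝ) < 2 * π := by positivity
  have hcont : Continuous fun t : ℝ => (t : AddCircle (2 * π)) := AddCircle.continuous_mk' _
  contrapose! h
  refine isPreconnected_of_forall_pair ?_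
  rintro _ ⟨a, ha, rfl⟩ _ ⟨b₀, hb₀, rfl⟩
  replace ha : F a < lam := ha
  replace hb₀ : F b₀ < lam := hb₀
  obtain ⟨b, hb, k, hbk⟩ : ∃ b ∈ Ico a (a + 2 * π), ∃ k : ℤ, b = b₀ + 2 * π * k := by
    refine ⟨toIcoMod hpi a b₀, toIcoMod_mem_Ico hpi a b₀, -toIcoDiv hpi a b₀, ?_⟩
    rw [toIcoMod, zsmul_eq_mul]
    push_cast
    ring
  have hcoe : (b : AddCircle (2 * π)) = b₀ := by
    rw [← sub_eq_zero, ← AddCircle.coe_sub, AddCircle.coe_eq_zero_iff]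
    exact ⟨k, by rw [hbk, zsmul_eq_mul]; ring⟩
  have hb' : F b < lam := by rw [hbk, hF]; exact hb₀
  beta_reduce
  rw [← hcoe]
  have ha2 : F (a + 2 * π) = F a := by simpa using hF a 1
  -- If one of the two arcs joining a and b stays in the sublevel set, its image is a connected set
  -- containing both points. Otherwise each arc supplies a point p or q, which the negated
  -- conclusion forbids.
  by_cases h1 : ∀ p ∈ Icc a b, F p < lam
  · exact ⟨_, image_mono h1, mem_image_of_mem _ (left_mem_Icc.2 hb.1),
      mem_image_of_mem _ (right_mem_Icc.2 hb.1), isPreconnected_Icc.image _ hcont.continuousOn⟩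
  by_cases h2 : ∀ q ∈ Icc b (a + 2 * π), F q < lam
  · refine ⟨_, image_mono h2, ⟨a + 2 * π, right_mem_Icc.2 hb.2.le, ?_⟩,
      mem_image_of_mem _ (left_mem_Icc.2 hb.2.le), isPreconnected_Icc.image _ hcont.continuousOn⟩
    simp
  push Not at h1 h2
  obtain ⟨p, hp, hpl⟩ := h1
  obtain ⟨q, hq, hql⟩ := h2
  refine absurd hql (not_le.2 (h a p b q ?_ ?_ ?_ ?_ ha hpl hb'))
  · refine lt_of_le_of_ne hp.1 ?_
    rintro rfl
    linarith
  · refine lt_of_le_of_ne hp.2 ?_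
    rintro rfl
    linarith
  · refine lt_of_le_of_ne hq.1 ?_
    rintro rfl
    linarith
  · refine lt_of_le_of_ne hq.2 ?_
    rintro rfl
    linarith

end Circle

/-! ### Primitives of the symbol, resonance and homogeneity. -/

section Primitive

variable {N : ℕ} {Q : SmoothTorus (N + 1) →L[ℂ] SmoothTorus (N + 1)} {c : ℝ → (Fin N → ℤ) → ℂ}

/-- The primitive of `c(·, ξ)` that vanishes at `0`. -/
def primitive (c : ℝ → (Fin N → ℤ) → ℂ) (ξ : Fin N → ℤ) (t : ℝ) : ℂ := ∫ s in (0 : ℝ)..t, c s ξ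

theorem HasTubeSymbol.hasDerivAt_primitive (hc : HasTubeSymbol Q c) (ξ : Fin N → ℤ) (t : ℝ) :
    HasDerivAt (primitive c ξ) (c t ξ) t :=
  (hc.contDiff ξ).continuous.integral_hasStrictDerivAt 0 t |>.hasDerivAt

theorem contDiff_of_hasDerivAt {E : Type*} [NormedAddCommGroup E] [NormedSpace ℝ E] {f f' : ℝ → E}
    (hf : ∀ t, HasDerivAt f (f' t) t) (hf' : ContDiff ℝ ∞ f') : ContDiff ℝ ∞ f := by
  rw [contDiff_infty_iff_deriv]
  refine ⟨fun t => (hf t).differentiableAt, ?_⟩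
  rwa [funext fun t => (hf t).deriv]

theorem HasTubeSymbol.contDiff_primitive (hc : HasTubeSymbol Q c) (ξ : Fin N → ℤ) :
    ContDiff ℝ ∞ (primitive c ξ) :=
  contDiff_of_hasDerivAt (hc.hasDerivAt_primitive ξ) (hc.contDiff ξ)

/-- The primitive `∫₀ᵗ f` of a continuous periodic function is quasi-periodic. -/
theorem integral_add_period {E : Type*} [NormedAddCommGroup E] [NormedSpace ℝ E] {f : ℝ → E}
    (hf : Continuous f) (hp : Function.Periodic f (2 * π)) (t : ℝ) (k : ℤ) :
    ∫ s in (0 : ℝ)..(t + 2 * π * k), f s =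
      (∫ s in (0 : ℝ)..t, f s) + k • ∫ s in (0 : ℝ)..(2 * π), f s := by
  have hi : ∀ a b, IntervalIntegrable f volume a b := fun a b => hf.intervalIntegrable a b
  have h1 := hp.intervalIntegral_add_zsmul_eq k t hi
  have h2 := hp.intervalIntegral_add_eq t 0
  rw [← intervalIntegral.integral_add_adjacent_intervals (hi 0 t) (hi t _)]
  rw [zero_add] at h2
  rw [← h2, ← h1, zsmul_eq_mul, mul_comm (k : ℝ)]

/-- Resonance makes the increments multiples of 2π, which is what makes e^{-iC} periodic. -/
theorem HasTubeSymbol.primitive_add_period (hc : HasTubeSymbol Q c) {ξ : Fin N → ℤ} {l : ℤ}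
    (hl : average c ξ = l) (t : ℝ) (k : ℤ) :
    primitive c ξ (t + 2 * π * k) = primitive c ξ t + 2 * π * (k * l : ℤ) := by
  have h1 := integral_add_period (hc.contDiff ξ).continuous
    (fun t => by simpa using hc.periodic ξ t 1) t k
  have hpi : (2 * (π : ℂ)) ≠ 0 := by simp [Real.pi_ne_zero]
  rw [average, inv_mul_eq_iff_eq_mul₀ hpi] at hl
  rw [primitive, h1, hl, primitive, zsmul_eq_mul]
  push_cast
  ring

theorem HasTubeSymbol.im_primitive (hc : HasTubeSymbol Q c) {B : ℝ → (Fin N → ℤ) → ℝ}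
    (hB : IsPrimitiveIm c B) (ξ : Fin N → ℤ) (t : ℝ) :
    (primitive c ξ t).im = B t ξ - B 0 ξ := by
  have hd : ∀ t, HasDerivAt (fun t => (primitive c ξ t).im - B t ξ) 0 t := by
    intro t
    have h1 : HasDerivAt (fun t => (primitive c ξ t).im) (c t ξ).im t :=
      Complex.imCLM.hasFDerivAt.comp_hasDerivAt t (hc.hasDerivAt_primitive ξ t)
    exact (h1.sub (hB ξ t)).congr_deriv (sub_self _)
  have h2 := is_const_of_deriv_eq_zero (fun t => (hd t).differentiableAt)
    (fun t => (hd t).deriv) t 0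
  simp only [primitive, intervalIntegral.integral_same, Complex.zero_im] at h2 ⊢
  linarith

theorem HasTubeSymbol.B_periodic (hc : HasTubeSymbol Q c) {B : ℝ → (Fin N → ℤ) → ℝ}
    (hB : IsPrimitiveIm c B) {ξ : Fin N → ℤ} (hξ : ξ ∈ resonantSet c) (t : ℝ) (k : ℤ) :
    B (t + 2 * π * k) ξ = B t ξ := by
  obtain ⟨l, hl⟩ := hξ
  have h1 := congrArg Complex.im (hc.primitive_add_period hl t k)
  rw [Complex.add_im, hc.im_primitive hB, hc.im_primitive hB] at h1
  have : (2 * (π : ℂ) * ((k * l : ℤ) : ℂ)).im = 0 := by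
    have : (2 * (π : ℂ) * ((k * l : ℤ) : ℂ)) = ((2 * π * (k * l : ℤ) : ℝ) : ℂ) := by push_cast; ring
    rw [this, Complex.ofReal_im]
  linarith

theorem IsPosHomogeneous.average_nsmul {m : ℕ} (hhom : IsPosHomogeneous m c) {n : ℕ} (hn : 1 ≤ n)
    (ξ : Fin N → ℤ) : average c (n • ξ) = n ^ m * average c ξ := by
  simp only [average, hhom n hn, intervalIntegral.integral_const_mul]
  ring

theorem IsPosHomogeneous.nsmul_mem_resonantSet {m : ℕ} (hhom : IsPosHomogeneous m c) {n : ℕ}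
    (hn : 1 ≤ n) {ξ : Fin N → ℤ} (hξ : ξ ∈ resonantSet c) : n • ξ ∈ resonantSet c := by
  obtain ⟨l, hl⟩ := hξ
  exact ⟨n ^ m * l, by rw [hhom.average_nsmul hn, hl]; push_cast; ring⟩

/-- Only differences scale: the constant of integration in B(·, ξ) is chosen independently for each
ξ. -/
theorem IsPosHomogeneous.B_sub_B {m : ℕ} (hhom : IsPosHomogeneous m c) {B : ℝ → (Fin N → ℤ) → ℝ}
    (hB : IsPrimitiveIm c B) {n : ℕ} (hn : 1 ≤ n) (ξ : Fin N → ℤ) (s t : ℝ) :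
    B t (n • ξ) - B s (n • ξ) = n ^ m * (B t ξ - B s ξ) := by
  have hd : ∀ t, HasDerivAt (fun t => B t (n • ξ) - n ^ m * B t ξ) 0 t := by
    intro t
    refine ((hB (n • ξ) t).sub ((hB ξ t).const_mul _)).congr_deriv ?_
    have : ((n : ℂ) ^ m * c t ξ) = (((n : ℝ) ^ m : ℝ) : ℂ) * c t ξ := by push_cast; ring
    rw [hhom n hn, this, Complex.im_ofReal_mul, sub_self]
  have h2 := is_const_of_deriv_eq_zero (fun t => (hd t).differentiableAt)
    (fun t => (hd t).deriv) t s
  linarith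

theorem intNorm_nsmul (n : ℕ) (ξ : Fin N → ℤ) : intNorm (n • ξ) = n * intNorm ξ := by
  have : ∑ i, (((n • ξ) i : ℤ) : ℝ) ^ 2 = (n : ℝ) ^ 2 * ∑ i, (ξ i : ℝ) ^ 2 := by
    rw [Finset.mul_sum]
    refine Finset.sum_congr rfl fun i _ => ?_
    simp [mul_pow]
  rw [intNorm, this, Real.sqrt_mul (by positivity), Real.sqrt_sq (by positivity), intNorm]

theorem intNorm_pos {ξ : Fin N → ℤ} (hξ : ξ ≠ 0) : 0 < intNorm ξ := by
  obtain ⟨j, hj⟩ := Function.ne_iff.1 hξ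
  have hj' : (0 : ℝ) < (ξ j : ℝ) ^ 2 := by
    have : (ξ j : ℝ) ≠ 0 := by exact_mod_cast hj
    positivity
  exact Real.sqrt_pos.2 (hj'.trans_le (Finset.single_le_sum (f := fun i => (ξ i : ℝ) ^ 2)
    (fun i _ => sq_nonneg _) (Finset.mem_univ j)))

/-! ### Failure of (β)_D along the ray. -/

/-- `(β)_D` fails at `ξ` if, on both sides of a point `γ`, there are long enough intervals on which
`B(·, ξ)` is much smaller than at `γ`. -/
theorem not_satisfiesBeta {m D : ℝ} {B : ℝ → (Fin N → ℤ) → ℝ} {ξ : Fin N → ℤ}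
    {tmax α γ β δ : ℝ} (hα : tmax - 2 * π < α) (hαγ : α < γ) (hγβ : γ < β) (hβ : β < tmax)
    (hδ : 0 < δ) (hlen : intNorm ξ ^ (-m) ≤ 2 * δ) (hmax : B γ ξ ≤ B tmax ξ)
    (hmax' : B γ ξ ≤ B (tmax - 2 * π) ξ)
    (hlog : 0 ≤ D * Real.log (intNorm ξ))
    (h1 : ∀ s ∈ Ioo (α - δ) (α + δ), D * Real.log (intNorm ξ) < B γ ξ - B s ξ)
    (h2 : ∀ s ∈ Ioo (β - δ) (β + δ), D * Real.log (intNorm ξ) < B γ ξ - B s ξ) :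
    ¬ SatisfiesBeta m D B ξ tmax := by
  intro h
  -- Inside the windows B is strictly below B γ, so they contain none of γ, tmax and tmax - 2π.
  -- Hence each window lies entirely within its own arc.
  have out : ∀ x r, B γ ξ ≤ B r ξ →
      (∀ s ∈ Ioo (x - δ) (x + δ), D * Real.log (intNorm ξ) < B γ ξ - B s ξ) →
      r ∉ Ioo (x - δ) (x + δ) := by
    intro x r hr hx hmem
    have := hx r hmem
    linarith
  have o1 := out α γ le_rfl h1
  have o2 := out α _ hmax' h1
  have o3 := out β γ le_rfl h2
  have o4 := out β _ hmax h2
  simp only [mem_Ioo, not_and_or, not_lt] at o1 o2 o3 o4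
  have o1' : α + δ ≤ γ := o1.resolve_left (by linarith)
  have o2' : tmax - 2 * π ≤ α - δ := o2.resolve_right (by linarith)
  have o3' : γ ≤ β - δ := o3.resolve_right (by linarith)
  have o4' : β + δ ≤ tmax := o4.resolve_left (by linarith)
  rcases h γ ⟨by linarith, by linarith⟩ with h | h
  · obtain ⟨s, hs, hs'⟩ := h (β - δ) (β + δ) (by linarith)
      (fun s hs => ⟨by linarith [hs.1], by linarith [hs.2]⟩) (by linarith)
    linarith [h2 s hs]
  · obtain ⟨s, hs, hs'⟩ := h (α - δ) (α + δ) (by linarith)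
      (fun s hs => ⟨by linarith [hs.1], by linarith [hs.2]⟩) (by linarith)
    linarith [h1 s hs]

/-- In `(tmax - 2π, tmax)` there are translates of `a` and `b`, separated by a point where `F` is
at least `lam`. -/
theorem exists_separated_in_period {F : ℝ → ℝ} (hF : ∀ (t : ℝ) (k : ℤ), F (t + 2 * π * k) = F t)
    {lam a p b q tmax : ℝ} (hap : a < p) (hpb : p < b) (hbq : b < q) (hqa : q < a + 2 * π)
    (ha : F a < lam) (hp : lam ≤ F p) (hb : F b < lam) (hq : lam ≤ F q) (ht : lam ≤ F tmax) :
    ∃ (α γ β : ℝ) (k l : ℤ), tmax - 2 * π < α ∧ α < γ ∧ γ < β ∧ β < tmax ∧ lam ≤ F γ ∧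
      ((α = a + 2 * π * k ∧ β = b + 2 * π * l) ∨ (α = b + 2 * π * l ∧ β = a + 2 * π * k)) := by
  have hpi : (0 : ℝ) < 2 * π := by positivity
  have hrep : ∀ x, F x < lam → ∃ k : ℤ, x + 2 * π * k ∈ Ioo (tmax - 2 * π) tmax := by
    intro x hx
    have h1 := toIocMod_mem_Ioc hpi (tmax - 2 * π) x
    have h2 : toIocMod hpi (tmax - 2 * π) x =
        x + 2 * π * ((-toIocDiv hpi (tmax - 2 * π) x : ℤ) : ℝ) := by
      rw [toIocMod, zsmul_eq_mul]
      push_cast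
      ring
    rw [h2] at h1
    refine ⟨_, h1.1, lt_of_le_of_ne (by linarith [h1.2]) fun h => ?_⟩
    rw [← h, hF] at ht
    linarith
  obtain ⟨k, hk⟩ := hrep a ha
  obtain ⟨l, hl⟩ := hrep b hb
  -- Both translates lie in one open period and 0 < b - a < 2π. If k = l the translate of a comes
  -- first and p separates them; if k = l + 1 the order is reversed and q separates them.
  have hkl : k = l ∨ k = l + 1 := by
    have h1 : (2 * π) * ((k : ℝ) - l) < (2 * π) * 2 := by linarith [hk.2, hl.1]
    have h2 : (2 * π) * (-1) < (2 * π) * ((k : ℝ) - l) := by linarith [hk.1, hl.2]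
    have h3 := lt_of_mul_lt_mul_left h1 hpi.le
    have h4 := lt_of_mul_lt_mul_left h2 hpi.le
    have h5 : k - l < 2 := by exact_mod_cast h3
    have h6 : -1 < k - l := by exact_mod_cast h4
    omega
  rcases hkl with rfl | rfl
  · exact ⟨_, p + 2 * π * k, _, k, k, hk.1, by linarith, by linarith, hl.2, by rwa [hF],
      Or.inl ⟨rfl, rfl⟩⟩
  · refine ⟨_, q + 2 * π * l, _, l + 1, l, hl.1, by linarith, ?_, hk.2, by rwa [hF],
      Or.inr ⟨rfl, rfl⟩⟩
    push_cast
    linarith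

/-- The windows around a and b are chosen once at ξ₀ and do not depend on n, whereas the drop of B
on them grows like n^m. -/
theorem exists_forall_not_satisfiesBeta {m : ℕ} (hm : 1 ≤ m) (hc : HasTubeSymbol Q c)
    (hhom : IsPosHomogeneous m c) {B : ℝ → (Fin N → ℤ) → ℝ} (hB : IsPrimitiveIm c B)
    {ξ₀ : Fin N → ℤ} (hξ₀ : ξ₀ ≠ 0) (hZ : ξ₀ ∈ resonantSet c) {lam a p b q : ℝ}
    (hap : a < p) (hpb : p < b) (hbq : b < q) (hqa : q < a + 2 * π)
    (ha : B a ξ₀ < lam) (hp : lam ≤ B p ξ₀) (hb : B b ξ₀ < lam) (hq : lam ≤ B q ξ₀)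
    {D : ℝ} (hD : 0 < D) :
    ∃ n₀ : ℕ, ∀ n : ℕ, n₀ ≤ n → n • ξ₀ ∈ resonantSet c \ {0} ∧
      ∀ tmax : ℝ, (∀ t : ℝ, B t (n • ξ₀) ≤ B tmax (n • ξ₀)) →
        ¬ SatisfiesBeta (m : ℝ) D B (n • ξ₀) tmax := by
  have hper := hc.B_periodic hB hZ
  obtain ⟨lam', hl1, hl2⟩ := exists_between (max_lt ha hb)
  have hcont : Continuous fun t => B t ξ₀ :=
    continuous_iff_continuousAt.2 fun t => (hB ξ₀ t).continuousAt
  have hopen : IsOpen {t | B t ξ₀ < lam'} := isOpen_lt hcont continuous_const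
  obtain ⟨δ₁, hδ₁, hδa⟩ := Metric.isOpen_iff.1 hopen a ((le_max_left _ _).trans_lt hl1)
  obtain ⟨δ₂, hδ₂, hδb⟩ := Metric.isOpen_iff.1 hopen b ((le_max_right _ _).trans_lt hl1)
  set δ := min δ₁ δ₂
  have hδ : 0 < δ := lt_min hδ₁ hδ₂
  have hr := intNorm_pos hξ₀
  have htend : Tendsto (fun n : ℕ => (n : ℝ) * intNorm ξ₀) atTop atTop :=
    tendsto_natCast_atTop_atTop.atTop_mul_const hr
  have hε : 0 < (lam - lam') / intNorm ξ₀ := div_pos (by linarith) hr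
  have ev1 : ∀ᶠ n : ℕ in atTop, ((n : ℝ) * intNorm ξ₀) ^ (-(m : ℝ)) < 2 * δ :=
    ((tendsto_rpow_neg_atTop (by exact_mod_cast hm)).comp htend).eventually
      (gt_mem_nhds (by positivity))
  have ev2 : ∀ᶠ n : ℕ in atTop, 1 < (n : ℝ) * intNorm ξ₀ := htend.eventually_gt_atTop 1
  have ev3 : ∀ᶠ n : ℕ in atTop, D * Real.log ((n : ℝ) * intNorm ξ₀) < n * (lam - lam') := by
    -- The factor 2 in 2D turns the non-strict little-o bound into the strict inequality, as the
    -- logarithm is positive.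
    have h1 := htend.eventually (Real.isLittleO_log_id_atTop.def
      (show 0 < (lam - lam') / intNorm ξ₀ / (2 * D) by positivity))
    filter_upwards [h1, ev2] with n hn hn2
    have hn0 : 0 < (n : ℝ) * intNorm ξ₀ := by linarith
    rw [Real.norm_of_nonneg (Real.log_nonneg hn2.le), id, Real.norm_of_nonneg hn0.le] at hn
    have e : (lam - lam') / intNorm ξ₀ / (2 * D) * (n * intNorm ξ₀) =
        n * (lam - lam') / (2 * D) := by
      field_simp
    rw [e, le_div_iff₀ (by positivity)] at hn
    have := Real.log_pos hn2
    nlinarith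
  obtain ⟨n₀, hn₀⟩ := eventually_atTop.1 ((ev1.and (ev2.and ev3)).and (eventually_ge_atTop 1))
  refine ⟨n₀, fun n hn => ?_⟩
  obtain ⟨⟨h1, h2, h3⟩, hn1⟩ := hn₀ n hn
  refine ⟨⟨hhom.nsmul_mem_resonantSet hn1 hZ, ?_⟩, fun tmax hmax => ?_⟩
  · rw [mem_singleton_iff, smul_eq_zero]
    rintro (h | h)
    · omega
    · exact hξ₀ h
  have hnpos : (0 : ℝ) < (n : ℝ) ^ m := by positivity
  have hcmp : ∀ s t, B s (n • ξ₀) ≤ B t (n • ξ₀) ↔ B s ξ₀ ≤ B t ξ₀ := by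
    intro s t
    rw [← sub_nonneg, hhom.B_sub_B hB hn1, mul_nonneg_iff_of_pos_left hnpos, sub_nonneg]
  have ht : lam ≤ B tmax ξ₀ := hp.trans ((hcmp _ _).1 (hmax p))
  obtain ⟨α, γ, β, k, l, hα, hαγ, hγβ, hβ, hγ, hab⟩ := exists_separated_in_period
    (F := fun t => B t ξ₀) hper hap hpb hbq hqa ha hp hb hq ht
  have hnear : ∀ (x : ℝ) (k : ℤ), (∀ s, |s - x| < δ → B s ξ₀ < lam') →
      ∀ s ∈ Ioo (x + 2 * π * k - δ) (x + 2 * π * k + δ),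
        D * Real.log (intNorm (n • ξ₀)) < B γ (n • ξ₀) - B s (n • ξ₀) := by
    intro x k hx s hs
    have e1 := hx (s - 2 * π * k) (abs_lt.2 ⟨by linarith [hs.1], by linarith [hs.2]⟩)
    have e2 := hper (s - 2 * π * k) k
    rw [sub_add_cancel] at e2
    rw [← e2] at e1
    rw [hhom.B_sub_B hB hn1, intNorm_nsmul]
    have hn1' : (1 : ℝ) ≤ n := by exact_mod_cast hn1
    have e3 : (n : ℝ) ≤ (n : ℝ) ^ m := le_self_pow₀ hn1' (by omega)
    calc _ < (n : ℝ) * (lam - lam') := h3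
      _ ≤ (n : ℝ) ^ m * (lam - lam') := by
        gcongr
      _ ≤ _ := by
        gcongr
  have na : ∀ s, |s - a| < δ → B s ξ₀ < lam' := fun s hs => hδa (hs.trans_le (min_le_left _ _))
  have nb : ∀ s, |s - b| < δ → B s ξ₀ < lam' := fun s hs => hδb (hs.trans_le (min_le_right _ _))
  have hmax' : B γ (n • ξ₀) ≤ B (tmax - 2 * π) (n • ξ₀) := by
    have e := hper (tmax - 2 * π) 1
    rw [Int.cast_one, mul_one, sub_add_cancel] at e
    rw [hcmp, ← e, ← hcmp]
    exact hmax γ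
  have hlog : 0 ≤ D * Real.log (intNorm (n • ξ₀)) := by
    rw [intNorm_nsmul]
    exact mul_nonneg hD.le (Real.log_nonneg h2.le)
  have hlen : intNorm (n • ξ₀) ^ (-(m : ℝ)) ≤ 2 * δ := by
    rw [intNorm_nsmul]
    exact h1.le
  rcases hab with ⟨rfl, rfl⟩ | ⟨rfl, rfl⟩
  · exact not_satisfiesBeta hα hαγ hγβ hβ hδ hlen (hmax γ) hmax' hlog (hnear a k na)
      (hnear b l nb)
  · exact not_satisfiesBeta hα hαγ hγβ hβ hδ hlen (hmax γ) hmax' hlog (hnear b l nb)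
      (hnear a k na)

end Primitive

/-! ### Periodic bump functions and localized exponentials. -/

section Bump

/-- A smooth `2π`-periodic function that is positive within distance `δ` of `2πℤ` and vanishes
elsewhere. -/
def periodicBump (δ t : ℝ) : ℝ := expNegInvGlue (Real.cos t - Real.cos δ)

theorem contDiff_periodicBump (δ : ℝ) : ContDiff ℝ ∞ (periodicBump δ) :=
  expNegInvGlue.contDiff.comp (Real.contDiff_cos.sub contDiff_const)

theorem periodicBump_periodic (δ : ℝ) : Function.Periodic (periodicBump δ) (2 * π) := fun t => by
  simp [periodicBump]

theorem periodicBump_nonneg (δ t : ℝ) : 0 ≤ periodicBump δ t := expNegInvGlue.nonneg _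

theorem periodicBump_zero_pos {δ : ℝ} (h0 : 0 < δ) (hδ : δ ≤ π) : 0 < periodicBump δ 0 := by
  refine expNegInvGlue.pos_of_pos (sub_pos.2 ?_)
  exact Real.cos_lt_cos_of_nonneg_of_le_pi le_rfl hδ h0

theorem periodicBump_eq_zero {δ t : ℝ} (h0 : 0 ≤ δ) (h1 : δ ≤ t) (h2 : t ≤ 2 * π - δ) :
    periodicBump δ t = 0 := by
  refine expNegInvGlue.zero_of_nonpos (sub_nonpos.2 ?_)
  rcases le_total t π with h | h
  · exact Real.cos_le_cos_of_nonneg_of_le_pi h0 h h1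
  · rw [← Real.cos_two_pi_sub t]
    exact Real.cos_le_cos_of_nonneg_of_le_pi h0 (by linarith) (by linarith)

theorem exists_abs_sub_le_of_cos_le {δ t : ℝ} (h0 : 0 ≤ δ)
    (h : Real.cos δ ≤ Real.cos t) : ∃ k : ℤ, |t - 2 * π * k| ≤ δ := by
  have hpi : (0 : ℝ) < 2 * π := by positivity
  have h1 := toIocMod_mem_Ioc hpi (-π) t
  refine ⟨toIocDiv hpi (-π) t, ?_⟩
  have h2 : toIocMod hpi (-π) t = t - 2 * π * toIocDiv hpi (-π) t := by
    rw [toIocMod, zsmul_eq_mul, mul_comm]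
  rw [h2] at h1
  have h3 : Real.cos t = Real.cos |t - 2 * π * toIocDiv hpi (-π) t| := by
    rw [Real.cos_abs, mul_comm (2 * π), Real.cos_sub_int_mul_two_pi]
  rw [h3] at h
  by_contra! hlt
  have := Real.cos_lt_cos_of_nonneg_of_le_pi h0
    (abs_le.2 ⟨h1.1.le, by linarith [h1.2]⟩ : |t - 2 * π * toIocDiv hpi (-π) t| ≤ π) hlt
  linarith

end Bump

/-- Derivative bounds for a localized exponential with large parameters. -/
theorem exists_bound_iteratedFDeriv_mul_exp {n : ℕ} (X : SmoothTorus n)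
    {F₁ F₂ : (Fin n → ℝ) → ℂ} (hF₁ : ContDiff ℝ ∞ F₁) (hF₂ : ContDiff ℝ ∞ F₂)
    (hp₁ : ∀ k : Fin n → ℤ, ∃ z : ℂ, ∀ y, F₁ (fun i => y i + 2 * π * (k i : ℝ)) = F₁ y + z)
    (hp₂ : ∀ k : Fin n → ℤ, ∃ z : ℂ, ∀ y, F₂ (fun i => y i + 2 * π * (k i : ℝ)) = F₂ y + z)
    {S : Set (Fin n → ℝ)} (hS : IsClosed S) (hX : ∀ y ∉ S, X y = 0) {ε : ℝ}
    (hre₁ : ∀ y ∈ S, (F₁ y).re ≤ -ε) (hre₂ : ∀ y, (F₂ y).re = 0) (k : ℕ) :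
    ∃ K : ℝ, 0 ≤ K ∧ ∀ s r : ℝ, 1 ≤ s → 0 ≤ r → r ≤ s → ∀ y,
      ‖iteratedFDeriv ℝ k (fun y => X y * Complex.exp (s * F₁ y + r * F₂ y)) y‖
        ≤ K * (s ^ k * Real.exp (-ε * s)) := by
  choose KX hKX using X.exists_bound_iteratedFDeriv
  choose K₁ hK₁ using exists_bound_iteratedFDeriv_of_quasiperiodic hF₁ hp₁
  choose K₂ hK₂ using exists_bound_iteratedFDeriv_of_quasiperiodic hF₂ hp₂
  have hKX0 : ∀ i, 0 ≤ KX i := fun i => (norm_nonneg _).trans (hKX i 0)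
  have hK0 : ∀ i, 0 ≤ K₁ i + K₂ i := fun i =>
    add_nonneg ((norm_nonneg _).trans (hK₁ i 0)) ((norm_nonneg _).trans (hK₂ i 0))
  set L : ℝ := 1 + ∑ i ∈ Finset.range k, (K₁ i + K₂ i)
  have hL : 1 ≤ L := le_add_of_nonneg_right (Finset.sum_nonneg fun i _ => hK0 i)
  refine ⟨∑ i ∈ Finset.range (k + 1), (k.choose i : ℝ) * KX i * ((k - i).factorial * L ^ k),
    Finset.sum_nonneg fun i _ => mul_nonneg (mul_nonneg (by positivity) (hKX0 i)) (by positivity),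
    fun s r hs hr hrs y => ?_⟩
  have hF : ContDiff ℝ ∞ fun y => (s : ℂ) * F₁ y + r * F₂ y :=
    (contDiff_const.mul hF₁).add (contDiff_const.mul hF₂)
  -- On S use Leibniz and the bound on Re F₁; the imaginary phase F₂ does not affect the modulus,
  -- and r ≤ s bounds its derivatives. Off the closed set S the function vanishes locally, with all
  -- its derivatives.
  by_cases hy : y ∈ S
  · refine (norm_iteratedFDeriv_mul_le (N := ∞) X.contDiff hF.cexp y (mod_cast le_top)).trans ?_
    rw [Finset.sum_mul]
    refine Finset.sum_le_sum fun i hi => ?_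
    have hik : i ≤ k := Nat.lt_succ_iff.1 (Finset.mem_range.1 hi)
    have hLs : 1 ≤ L * s := one_le_mul_of_one_le_of_one_le hL hs
    have h1 := norm_iteratedFDeriv_cexp_comp_le hF (k - i) y hLs (by
      rintro (_ | j) hj hjk
      · omega
      have e : (fun y => (s : ℂ) * F₁ y + r * F₂ y) = s • F₁ + r • F₂ := by
        funext y
        simp
      rw [e, iteratedFDeriv_add_apply (f := s • F₁) (g := r • F₂) ((hF₁.const_smul s).of_le (mod_cast le_top)).contDiffAt
        ((hF₂.const_smul r).of_le (mod_cast le_top)).contDiffAt,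
        iteratedFDeriv_const_smul_apply (hF₁.of_le (mod_cast le_top)).contDiffAt,
        iteratedFDeriv_const_smul_apply (hF₂.of_le (mod_cast le_top)).contDiffAt]
      refine (norm_add_le _ _).trans ?_
      rw [norm_smul, norm_smul, Real.norm_of_nonneg hr, Real.norm_of_nonneg (by linarith)]
      calc _ ≤ s * K₁ j + s * K₂ j := by
            gcongr
            · exact hK₁ j y
            · exact hK₂ j y
        _ = (K₁ j + K₂ j) * s := by ring
        _ ≤ L * s := by
          gcongr
          exact (Finset.single_le_sum (f := fun j => K₁ j + K₂ j) (fun i _ => hK0 i)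
            (Finset.mem_range.2 (by omega))).trans (le_add_of_nonneg_left zero_le_one))
    have h2 : ‖Complex.exp ((s : ℂ) * F₁ y + r * F₂ y)‖ ≤ Real.exp (-ε * s) := by
      rw [Complex.norm_exp, Complex.add_re, Complex.re_ofReal_mul, Complex.re_ofReal_mul, hre₂ y,
        mul_zero, add_zero]
      refine Real.exp_le_exp.2 ?_
      nlinarith [hre₁ y hy]
    have h3 : (L * s) ^ (k - i) ≤ L ^ k * s ^ k := by
      rw [← mul_pow]
      exact pow_le_pow_right₀ hLs (Nat.sub_le k i)
    calc _ ≤ (k.choose i : ℝ) * KX i *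
          ((k - i).factorial * Real.exp (-ε * s) * (L ^ k * s ^ k)) := by
          have := hKX0 i
          gcongr
          · exact hKX i y
          · refine h1.trans ?_
            gcongr
      _ = _ := by ring
  · have h1 : iteratedFDeriv ℝ k (fun y => X y * Complex.exp (s * F₁ y + r * F₂ y)) y = 0 := by
      by_contra hne
      refine hy (closure_minimal ?_ hS (support_iteratedFDeriv_subset (𝕜 := ℝ) k hne))
      intro z hz
      by_contra hzS
      exact hz (by simp [hX z hzS])
    rw [h1, norm_zero]
    exact mul_nonneg (Finset.sum_nonneg fun i _ =>
      mul_nonneg (mul_nonneg (by positivity) (hKX0 i)) (by positivity)) (by positivity)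

/-! ### The range of P is not closed. -/

section Nonsolvability

variable {N : ℕ} {Q : SmoothTorus (N + 1) →L[ℂ] SmoothTorus (N + 1)} {c : ℝ → (Fin N → ℤ) → ℂ}

/-- If `χ` has mean value zero, then `χ(t) e^{-i C(t) - μ} e^{i x · ξ}` is in the range of `P`,
where `C' = c(·, ξ)`. -/
theorem HasTubeSymbol.exists_opP_eq_wave (hc : HasTubeSymbol Q c) {ξ : Fin N → ℤ} {χ : ℝ → ℝ}
    (hχ : ContDiff ℝ ∞ χ) (hχp : Function.Periodic χ (2 * π)) (hχ0 : ∫ t in (0 : ℝ)..(2 * π), χ t = 0)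
    (hξ : ξ ∈ resonantSet c) (μ : ℝ) :
    ∃ v : SmoothTorus (N + 1), ∀ y, opP Q v y =
      wave (fun t => -Complex.I * χ t * Complex.exp (-Complex.I * primitive c ξ t - μ)) ξ y := by
  obtain ⟨l, hl⟩ := hξ
  set Φ : ℝ → ℝ := fun t => ∫ s in (0 : ℝ)..t, χ s with hΦ
  have hΦd : ∀ t, HasDerivAt Φ (χ t) t := fun t =>
    (hχ.continuous.integral_hasStrictDerivAt 0 t).hasDerivAt
  have hΦs : ContDiff ℝ ∞ Φ := contDiff_of_hasDerivAt hΦd hχ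
  have hΦp : ∀ (t : ℝ) (k : ℤ), Φ (t + 2 * π * k) = Φ t := by
    intro t k
    simp only [hΦ]
    rw [integral_add_period hχ.continuous hχp, hχ0, smul_zero, add_zero]
  set E : ℝ → ℂ := fun t => Complex.exp (-Complex.I * primitive c ξ t - μ) with hE
  have hEs : ContDiff ℝ ∞ E :=
    ((contDiff_const.mul (hc.contDiff_primitive ξ)).sub contDiff_const).cexp
  have hEd : ∀ t, HasDerivAt E (-Complex.I * c t ξ * E t) t := by
    intro t
    refine (((hc.hasDerivAt_primitive ξ t).const_mul (-Complex.I)).sub_const (μ : ℂ)).cexp.congr_deriv ?_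
    rw [mul_comm]
  have hEp : ∀ (t : ℝ) (k : ℤ), E (t + 2 * π * k) = E t := by
    intro t k
    simp only [hE]
    rw [Complex.exp_eq_exp_iff_exists_int]
    refine ⟨-(k * l), ?_⟩
    rw [hc.primitive_add_period hl]
    push_cast
    ring
  have hs : ContDiff ℝ ∞ fun t => (Φ t : ℂ) * E t := (Complex.ofRealCLM.contDiff.comp hΦs).mul hEs
  have hd : ∀ t, HasDerivAt (fun t => (Φ t : ℂ) * E t)
      (χ t * E t + Φ t * (-Complex.I * c t ξ * E t)) t := fun t =>
    (hΦd t).ofReal_comp.mul (hEd t)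
  -- Variation of constants: E solves (D_t + c(t, ξ))E = 0, so P only differentiates Φ. Mean zero of
  -- χ makes Φ periodic. No smallness of v is needed.
  let v : SmoothTorus (N + 1) := SmoothTorus.mk (wave (fun t => (Φ t : ℂ) * E t) ξ)
    (contDiff_wave hs ξ) (wave_periodic (fun t k => by rw [hΦp, hEp]) ξ)
  have hv : ∀ y, v y = wave (fun t => (Φ t : ℂ) * E t) ξ y := fun y => rfl
  refine ⟨v, fun y => ?_⟩
  rw [opP_apply, hc.apply_wave (hs.differentiable (by simp)) hv, funext hv, fderiv_wave_zero hd]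
  simp only [wave]
  linear_combination (-(Φ (y 0)) * c (y 0) ξ * E (y 0) *
    Complex.exp (Complex.I * (dot (Fin.tail y) ξ : ℝ))) * (-Complex.I_sq)

theorem IsPosHomogeneous.primitive_nsmul {m : ℕ} (hhom : IsPosHomogeneous m c) {n : ℕ} (hn : 1 ≤ n)
    (ξ : Fin N → ℤ) (t : ℝ) : primitive c (n • ξ) t = n ^ m * primitive c ξ t := by
  simp only [primitive, hhom n hn, intervalIntegral.integral_const_mul]

theorem integral_slab_periodicBump_pos {p b q δ : ℝ} (hpb : p < b) (hbq : b < q) (h0 : 0 < δ)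
    (hδ : δ ≤ π) : 0 < ∫ y in slab N p q, periodicBump δ (y 0 - b) := by
  have hcont : Continuous fun y : Fin (N + 1) → ℝ => periodicBump δ (y 0 - b) :=
    (contDiff_periodicBump δ).continuous.comp (by fun_prop)
  rw [slab, setIntegral_pos_iff_support_of_nonneg_ae
    (Eventually.of_forall fun y => periodicBump_nonneg δ _) hcont.integrableOn_Icc]
  have hopen : IsOpen (Function.support (fun y : Fin (N + 1) → ℝ => periodicBump δ (y 0 - b)) ∩
      Set.pi univ fun i => Ioo ((Fin.cons p 0 : Fin (N + 1) → ℝ) i)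
        ((Fin.cons q fun _ => 2 * π : Fin (N + 1) → ℝ) i)) :=
    hcont.isOpen_support.inter (isOpen_set_pi finite_univ fun _ _ => isOpen_Ioo)
  refine (hopen.measure_pos volume ⟨Fin.cons b fun _ => π, ?_, ?_⟩).trans_le (measure_mono ?_)
  · simpa using (periodicBump_zero_pos h0 hδ).ne'
  · intro i _
    refine Fin.cases ?_ (fun i => ?_) i
    · simpa using ⟨hpb, hbq⟩
    · simpa using ⟨Real.pi_pos, by linarith [Real.pi_pos]⟩
  · refine inter_subset_inter_right _ ?_
    rw [← pi_univ_Icc]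
    exact pi_mono fun i _ => Ioo_subset_Icc_self

/-- The value of a function in the range of `P` at the frequency `ξ` is controlled by the weight
`e^{i C}` at the end points of the interval, where `C' = c(·, ξ)`. -/
theorem HasTubeSymbol.norm_integral_slab_opP_le (hc : HasTubeSymbol Q c) {p q : ℝ} (hpq : p ≤ q)
    (u : SmoothTorus (N + 1)) {K : ℝ} (hK : ∀ y, ‖u y‖ ≤ K) (ξ : Fin N → ℤ) {W : ℝ}
    (hp : W ≤ (primitive c ξ p).im) (hq : W ≤ (primitive c ξ q).im) :
    ‖∫ y in slab N p q, opP Q u y *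
        wave (fun t => Complex.exp (Complex.I * primitive c ξ t)) (-ξ) y‖ ≤
      2 * (K * volume.real (Icc (0 : Fin N → ℝ) fun _ => 2 * π)) * Real.exp (-W) := by
  have hface : ∀ r : ℝ, W ≤ (primitive c ξ r).im →
      ‖∫ x in Icc (0 : Fin N → ℝ) (fun _ => 2 * π), u (Fin.cons r x) *
        wave (fun t => Complex.exp (Complex.I * primitive c ξ t)) (-ξ) (Fin.cons r x)‖ ≤
      K * Real.exp (-W) * volume.real (Icc (0 : Fin N → ℝ) fun _ => 2 * π) := by
    intro r hr
    refine norm_setIntegral_le_of_norm_le_const isCompact_Icc.measure_lt_top fun x _ => ?_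
    rw [norm_mul, norm_wave, Fin.cons_zero, Complex.norm_exp]
    refine mul_le_mul (hK _) (Real.exp_le_exp.2 ?_) (Real.exp_nonneg _)
      ((norm_nonneg _).trans (hK 0))
    simpa using hr
  rw [hc.integral_slab_opP hpq u ξ (hc.contDiff_primitive ξ) (hc.hasDerivAt_primitive ξ), norm_mul,
    norm_neg, Complex.norm_I, one_mul]
  refine (norm_sub_le _ _).trans ((add_le_add (hface q hq) (hface p hp)).trans (le_of_eq ?_))
  ring

/-- `P` is not globally solvable if there are points `a < p < b < q < a + 2π` with
`B(a), B(b) < lam ≤ B(p), B(q)` at some resonant frequency. -/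
theorem not_isGloballySolvable {m : ℕ} (hm : 1 ≤ m) (hc : HasTubeSymbol Q c)
    (hhom : IsPosHomogeneous m c) {B : ℝ → (Fin N → ℤ) → ℝ} (hB : IsPrimitiveIm c B)
    {ξ₀ : Fin N → ℤ} (hξ₀ : ξ₀ ≠ 0) (hZ : ξ₀ ∈ resonantSet c) {lam a p b q : ℝ}
    (hap : a < p) (hpb : p < b) (hbq : b < q) (hqa : q < a + 2 * π)
    (ha : B a ξ₀ < lam) (hp : lam ≤ B p ξ₀) (hb : B b ξ₀ < lam) (hq : lam ≤ B q ξ₀) :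
    ¬ IsGloballySolvable (opP Q) := by
  intro hclosed
  have hper := hc.B_periodic hB hZ
  obtain ⟨lam', hl1, hl2⟩ := exists_between (max_lt ha hb)
  have hcont : Continuous fun t => B t ξ₀ :=
    continuous_iff_continuousAt.2 fun t => (hB ξ₀ t).continuousAt
  have hopen : IsOpen {t | B t ξ₀ < lam'} := isOpen_lt hcont continuous_const
  obtain ⟨δ₁, hδ₁, hδa⟩ := Metric.isOpen_iff.1 hopen a ((le_max_left _ _).trans_lt hl1)
  obtain ⟨δ₂, hδ₂, hδb⟩ := Metric.isOpen_iff.1 hopen b ((le_max_right _ _).trans_lt hl1)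
  -- Strictly smaller than both radii, so that the closed supports of the bumps stay in the region B
  -- < lam'.
  obtain ⟨δ, hδ, hδlt⟩ := exists_between (lt_min (lt_min hδ₁ hδ₂) Real.pi_pos)
  have hδπ : δ ≤ π := (hδlt.trans_le (min_le_right _ _)).le
  have na : ∀ s, |s - a| ≤ δ → B s ξ₀ < lam' := fun s hs =>
    hδa (hs.trans_lt (hδlt.trans_le ((min_le_left _ _).trans (min_le_left _ _))))
  have nb : ∀ s, |s - b| ≤ δ → B s ξ₀ < lam' := fun s hs =>
    hδb (hs.trans_lt (hδlt.trans_le ((min_le_left _ _).trans (min_le_right _ _))))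
  -- With this ε, lam - ε is the midpoint of lam' and lam. Relative to μ, Im C is below -ε on the
  -- support of χ and at least ε at p and q.
  set ε : ℝ := (lam - lam') / 2 with hε
  have hεpos : 0 < ε := by rw [hε]; linarith
  set μ : ℝ := lam - ε - B 0 ξ₀ with hμ
  -- the amplitude and its support
  set χ : ℝ → ℝ := fun t => periodicBump δ (t - a) - periodicBump δ (t - b) with hχ
  have hχs : ContDiff ℝ ∞ χ :=
    ((contDiff_periodicBump δ).comp (contDiff_id.sub contDiff_const)).sub
      ((contDiff_periodicBump δ).comp (contDiff_id.sub contDiff_const))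
  have hbp : ∀ x, Function.Periodic (fun t => periodicBump δ (t - x)) (2 * π) := fun x =>
    (periodicBump_periodic δ).sub_const x
  have hχp : Function.Periodic χ (2 * π) := (hbp a).sub (hbp b)
  have hbi : ∀ x, ∫ t in (0 : ℝ)..(2 * π), periodicBump δ (t - x) =
      ∫ t in (0 : ℝ)..(2 * π), periodicBump δ t := by
    intro x
    rw [intervalIntegral.integral_comp_sub_right (fun t => periodicBump δ t)]
    have := (periodicBump_periodic δ).intervalIntegral_add_eq (0 - x) 0
    rw [zero_add] at this
    rw [← this]
    congr 1
    ring
  have hbint : ∀ x, IntervalIntegrable (fun t => periodicBump δ (t - x)) volume 0 (2 * π) :=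
    fun x => ((contDiff_periodicBump δ).continuous.comp (by fun_prop)).intervalIntegrable _ _
  have hχ0 : ∫ t in (0 : ℝ)..(2 * π), χ t = 0 := by
    simp only [hχ]
    rw [intervalIntegral.integral_sub (hbint a) (hbint b), hbi, hbi, sub_self]
  have hsupp : ∀ t, (Real.cos δ ≤ Real.cos (t - a) ∨ Real.cos δ ≤ Real.cos (t - b)) →
      B t ξ₀ < lam' := by
    have key : ∀ x, (∀ s, |s - x| ≤ δ → B s ξ₀ < lam') → ∀ t, Real.cos δ ≤ Real.cos (t - x) →
        B t ξ₀ < lam' := by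
      intro x hx t ht
      obtain ⟨k, hk⟩ := exists_abs_sub_le_of_cos_le hδ.le ht
      have e := hper (t - 2 * π * k) k
      rw [sub_add_cancel] at e
      rw [e]
      exact hx _ (by rwa [sub_right_comm])
    rintro t (h | h)
    · exact key a na t h
    · exact key b nb t h
  -- the terms of the series
  have hn1 : ∀ n : ℕ, 1 ≤ n + 1 := fun n => by omega
  choose v hv using fun n : ℕ => hc.exists_opP_eq_wave hχs hχp hχ0
    (hhom.nsmul_mem_resonantSet (hn1 n) hZ) (((n + 1 : ℕ) : ℝ) ^ m * μ)
  have hXs : ContDiff ℝ ∞ fun t => -Complex.I * (χ t : ℂ) :=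
    contDiff_const.mul (Complex.ofRealCLM.contDiff.comp hχs)
  have hχk : ∀ (t : ℝ) (k : ℤ), χ (t + 2 * π * k) = χ t := by
    intro t k
    rw [mul_comm]
    exact hχp.int_mul k t
  let X : SmoothTorus (N + 1) := SmoothTorus.mk (wave (fun t => -Complex.I * (χ t : ℂ)) 0)
    (contDiff_wave hXs 0) (wave_periodic (fun t k => by rw [hχk]) 0)
  have hX : ∀ y, X y = -Complex.I * (χ (y 0) : ℂ) := fun y =>
    wave_zero (fun t => -Complex.I * (χ t : ℂ)) y
  set F₁ : (Fin (N + 1) → ℝ) → ℂ := fun y => -Complex.I * primitive c ξ₀ (y 0) - μ with hF₁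
  set F₂ : (Fin (N + 1) → ℝ) → ℂ := fun y => Complex.I * (dot (Fin.tail y) ξ₀ : ℝ) with hF₂
  have hF₁s : ContDiff ℝ ∞ F₁ :=
    (contDiff_const.mul ((hc.contDiff_primitive ξ₀).comp (contDiff_apply ℝ ℝ 0))).sub
      contDiff_const
  have hF₂s : ContDiff ℝ ∞ F₂ :=
    contDiff_const.mul (Complex.ofRealCLM.contDiff.comp ((contDiff_dot ξ₀).comp
      (contDiff_pi.2 fun i => contDiff_apply ℝ ℝ i.succ)))
  have hp₁ : ∀ k : Fin (N + 1) → ℤ, ∃ z : ℂ, ∀ y,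
      F₁ (fun i => y i + 2 * π * (k i : ℝ)) = F₁ y + z := by
    obtain ⟨l, hl⟩ := hZ
    intro k
    refine ⟨-Complex.I * (2 * π * (k 0 * l : ℤ)), fun y => ?_⟩
    simp only [hF₁]
    rw [hc.primitive_add_period hl]
    ring
  have hp₂ : ∀ k : Fin (N + 1) → ℤ, ∃ z : ℂ, ∀ y,
      F₂ (fun i => y i + 2 * π * (k i : ℝ)) = F₂ y + z := by
    intro k
    refine ⟨Complex.I * (∑ i, 2 * π * (k i.succ : ℝ) * (ξ₀ i : ℝ) : ℝ), fun y => ?_⟩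
    simp only [hF₂, dot, Fin.tail, add_mul, Finset.sum_add_distrib]
    push_cast
    ring
  -- The amplitude phase scales with (n + 1)^m and the x-phase with n + 1, hence two separate
  -- parameters. The shift by 1 avoids the frequency 0.
  have hwave : ∀ n y, opP Q (v n) y =
      X y * Complex.exp ((((n + 1 : ℕ) : ℝ) ^ m : ℝ) * F₁ y + ((n + 1 : ℕ) : ℝ) * F₂ y) := by
    intro n y
    have hdot : dot (Fin.tail y) ((n + 1) • ξ₀) = ((n + 1 : ℕ) : ℝ) * dot (Fin.tail y) ξ₀ := by
      simp only [dot, Finset.mul_sum]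
      refine Finset.sum_congr rfl fun i _ => ?_
      simp
      ring
    rw [hv, hX, wave, Complex.exp_add, hdot, hhom.primitive_nsmul (hn1 n), mul_assoc]
    simp only [hF₁, hF₂]
    congr 3 <;> push_cast <;> ring
  set S : Set (Fin (N + 1) → ℝ) :=
    {y | Real.cos δ ≤ Real.cos (y 0 - a)} ∪ {y | Real.cos δ ≤ Real.cos (y 0 - b)}
  have hS : IsClosed S :=
    (isClosed_le continuous_const (by fun_prop)).union (isClosed_le continuous_const (by fun_prop))
  have hXS : ∀ y ∉ S, X y = 0 := by
    intro y hy
    have hy' : Real.cos (y 0 - a) < Real.cos δ ∧ Real.cos (y 0 - b) < Real.cos δ := by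
      constructor
      · exact not_le.1 fun h => hy (Or.inl h)
      · exact not_le.1 fun h => hy (Or.inr h)
    rw [hX]
    simp only [hχ, periodicBump]
    rw [expNegInvGlue.zero_of_nonpos (by linarith), expNegInvGlue.zero_of_nonpos (by linarith)]
    simp
  have hre₁ : ∀ y ∈ S, (F₁ y).re ≤ -ε := by
    intro y hy
    have h1 := hsupp (y 0) hy
    have h2 : (F₁ y).re = (primitive c ξ₀ (y 0)).im - μ := by simp [hF₁]
    rw [h2, hc.im_primitive hB]
    linarith
  have hre₂ : ∀ y, (F₂ y).re = 0 := fun y => by simp [hF₂]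
  choose K hK0 hK using exists_bound_iteratedFDeriv_mul_exp X hF₁s hF₂s hp₁ hp₂ hS hXS hre₁ hre₂
  -- The majorants form a subseries of ∑ M^k e^{-εM} over the natural numbers M = (n + 1)^m.
  have hinj : Function.Injective fun n : ℕ => (n + 1) ^ m := by
    intro i j hij
    exact Nat.succ_injective (Nat.pow_left_injective (by omega) hij)
  have hsummable : ∀ k : ℕ, Summable fun n : ℕ =>
      ((((n + 1 : ℕ) : ℝ) ^ m) ^ k * Real.exp (-ε * ((n + 1 : ℕ) : ℝ) ^ m)) := by
    intro k
    have := (Real.summable_pow_mul_exp_neg_nat_mul k hεpos).comp_injective hinj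
    refine this.congr fun n => ?_
    simp only [Function.comp]
    push_cast
    rfl
  obtain ⟨g, hg, -⟩ := SmoothTorus.exists_hasSum (fun n => opP Q (v n))
    (fun k n => K k * ((((n + 1 : ℕ) : ℝ) ^ m) ^ k * Real.exp (-ε * ((n + 1 : ℕ) : ℝ) ^ m)))
    (fun k => (hsummable k).mul_left _) (by
      intro k n y
      have h1 : (1 : ℝ) ≤ ((n + 1 : ℕ) : ℝ) := by exact_mod_cast hn1 n
      rw [funext (hwave n)]
      exact hK k _ _ (one_le_pow₀ h1) (by positivity) (le_self_pow₀ h1 (by omega)) y)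
  -- the sum is in the closure of the range
  obtain ⟨u, hu⟩ : g ∈ range (opP Q) :=
    hclosed.mem_of_tendsto hg (Eventually.of_forall fun s => sum_mem_range_opP s v)
  obtain ⟨Ku, hKu⟩ := u.exists_bound
  have hpq : p ≤ q := (hpb.trans hbq).le
  -- on the slab only the bump at `b` contributes
  set κ : ℝ := ∫ y in slab N p q, periodicBump δ (y 0 - b) with hκ
  have hκpos : 0 < κ := integral_slab_periodicBump_pos hpb hbq hδ hδπ
  have hχslab : ∀ y ∈ slab N p q, χ (y 0) = -periodicBump δ (y 0 - b) := by
    intro y hy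
    have hy1 : p ≤ y 0 := hy.1 0
    have hy2 : y 0 ≤ q := hy.2 0
    -- B ≥ lam at p and q, so neither point is within δ of a translate of a; the bump at a vanishes
    -- on all of [p, q].
    have h1 : a + δ ≤ p := by
      by_contra! h
      have := na p (abs_le.2 ⟨by linarith, by linarith⟩)
      linarith
    have h2 : q ≤ a + 2 * π - δ := by
      by_contra! h
      have e := hper (q - 2 * π) 1
      rw [Int.cast_one, mul_one, sub_add_cancel] at e
      have := na (q - 2 * π) (abs_le.2 ⟨by linarith, by linarith⟩)
      linarith
    simp only [hχ]
    rw [periodicBump_eq_zero hδ.le (by linarith) (by linarith), zero_sub]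
  have hbound : ∀ n : ℕ, κ ≤ 2 * (Ku * volume.real (Icc (0 : Fin N → ℝ) fun _ => 2 * π)) *
      (Real.exp (-ε * ((n + 1 : ℕ) : ℝ) ^ m)) := by
    intro n
    set M : ℝ := ((n + 1 : ℕ) : ℝ) ^ m with hM
    have hMpos : 0 < M := by positivity
    set ξ := (n + 1) • ξ₀ with hξ
    have him : ∀ t, (primitive c ξ t).im = M * (B t ξ₀ - B 0 ξ₀) := by
      intro t
      rw [hc.im_primitive hB, hhom.B_sub_B hB (hn1 n)]
    have hend : ∀ t, lam ≤ B t ξ₀ → M * μ + M * ε ≤ (primitive c ξ t).im := by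
      intro t ht
      rw [him, ← mul_add]
      gcongr
      linarith
    have h1 := hc.norm_integral_slab_opP_le hpq u hKu ξ (hend p hp) (hend q hq)
    set w : (Fin (N + 1) → ℝ) → ℂ :=
      wave (fun t => Complex.exp (Complex.I * primitive c ξ t)) (-ξ) with hw
    have hws : ContDiff ℝ ∞ fun t => Complex.exp (Complex.I * primitive c ξ t) :=
      (contDiff_const.mul (hc.contDiff_primitive ξ)).cexp
    have h2 := SmoothTorus.hasSum_integral hg (contDiff_wave hws (-ξ)).continuous
      (Fin.cons p 0) (Fin.cons q fun _ => 2 * π)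
    rw [← hw, ← slab] at h2
    -- Distinct multiples of ξ₀ ≠ 0 are distinct x-frequencies, hence orthogonal on the slab.
    have h3 : ∀ j, j ≠ n → ∫ y in slab N p q, opP Q (v j) y * w y = 0 := by
      intro j hj
      simp only [hv, hw, wave_mul_wave]
      refine integral_slab_wave hpq ((hXs.mul ((contDiff_const.mul
        (hc.contDiff_primitive _)).sub contDiff_const).cexp).mul hws) ?_
      rw [← sub_eq_add_neg, sub_ne_zero]
      intro h
      obtain ⟨i, hi⟩ := Function.ne_iff.1 hξ₀
      have hji := congrFun h i
      rw [hξ, Pi.smul_apply, Pi.smul_apply, nsmul_eq_mul, nsmul_eq_mul] at hji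
      have hji' := mul_right_cancel₀ hi hji
      exact hj (Nat.succ_injective (by exact_mod_cast hji'))
    have h4 := h2.unique (hasSum_single n h3)
    -- The weight cancels e^{-iC} exactly, leaving a constant times the bump at b, which has a fixed
    -- sign.
    have h5 : ∫ y in slab N p q, opP Q (v n) y * w y =
        (Complex.I * Real.exp (-(M * μ))) * κ := by
      rw [hκ, ← integral_complex_ofReal, ← integral_const_mul]
      refine setIntegral_congr_fun measurableSet_Icc fun y hy => ?_
      simp only [hv, hw, wave_mul_wave]
      rw [add_neg_cancel, wave_zero, hχslab y hy, mul_assoc, ← Complex.exp_add]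
      have : -Complex.I * primitive c ((n + 1) • ξ₀) (y 0) -
          ((((n + 1 : ℕ) : ℝ) ^ m * μ : ℝ) : ℂ) + Complex.I * primitive c ξ (y 0) =
          ((-(M * μ) : ℝ) : ℂ) := by
        rw [hξ, hM]
        push_cast
        ring
      rw [this, Complex.ofReal_exp]
      push_cast
      ring
    -- The common factor e^{-Mμ} cancels; only the gain e^{-Mε} from the end points remains.
    rw [hu, h4, h5, norm_mul, norm_mul, Complex.norm_I, one_mul, Complex.norm_real, Complex.norm_real,
      Real.norm_of_nonneg (Real.exp_nonneg _), Real.norm_of_nonneg hκpos.le, neg_add,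
      Real.exp_add, mul_comm (Real.exp _) (Real.exp _), ← mul_assoc,
      mul_comm (Real.exp _) κ] at h1
    have h6 := le_of_mul_le_mul_right h1 (Real.exp_pos _)
    rwa [mul_comm M, ← neg_mul] at h6
  have hlim : Tendsto (fun n : ℕ => 2 * (Ku * volume.real (Icc (0 : Fin N → ℝ) fun _ => 2 * π)) *
      (Real.exp (-ε * ((n + 1 : ℕ) : ℝ) ^ m))) atTop (𝓝 0) := by
    have := (hsummable 0).tendsto_atTop_zero.const_mul
      (2 * (Ku * volume.real (Icc (0 : Fin N → ℝ) fun _ => 2 * π)))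
    simpa only [pow_zero, one_mul, mul_zero] using this
  exact absurd (ge_of_tendsto' hlim hbound) (not_le.2 hκpos)

end Nonsolvability

end TorusPDO

end

theorem mainTheorem3 (N m : ℕ) (hm : 1 ≤ m)
    (Q : SmoothTorus (N + 1) →L[ℂ] SmoothTorus (N + 1)) (c : ℝ → (Fin N → ℤ) → ℂ)
    (hQ : IsPseudoDiff (m : ℝ) Q) (hc : HasTubeSymbol Q c) (hhom : IsPosHomogeneous m c)
    (B : ℝ → (Fin N → ℤ) → ℝ) (hB : IsPrimitiveIm c B)
    (ξ₀ : Fin N → ℤ) (hξ₀ : ξ₀ ≠ 0) (hZ : ξ₀ ∈ resonantSet c)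
    (hΩ : ∃ lam : ℝ, ¬ IsPreconnected (circleSublevel (fun t => B t ξ₀) lam)) :
    ¬ IsGloballySolvable (opP Q) ∧
      ∀ D : ℝ, 0 < D → ∃ n₀ : ℕ, ∀ n : ℕ, n₀ ≤ n →
        n • ξ₀ ∈ resonantSet c \ {0} ∧
        ∀ tmax : ℝ, (∀ t : ℝ, B t (n • ξ₀) ≤ B tmax (n • ξ₀)) →
          ¬ SatisfiesBeta (m : ℝ) D B (n • ξ₀) tmax := by
  obtain ⟨lam, hlam⟩ := hΩ
  obtain ⟨a, p, b, q, hap, hpb, hbq, hqa, ha, hp, hb, hq⟩ :=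
    exists_separated_of_not_isPreconnected (hc.B_periodic hB hZ) hlam
  exact ⟨not_isGloballySolvable hm hc hhom hB hξ₀ hZ hap hpb hbq hqa ha hp hb hq,
    fun D hD => exists_forall_not_satisfiesBeta hm hc hhom hB hξ₀ hZ hap hpb hbq hqa ha hp hb hq
      hD⟩
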